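/- **Setting.** Let $k,n,m\ge 1$, $r>0$, $B^k(r)=\{z\in\mathbb R^k:\|z\|_2\le r\}$, and let $G:B^k(r)\to\mathbb R^n$ be $L$-Lipschitz with $\|G(z)\|_2=1$ for all $z$, where $nLr\ge 2$. Let $\mathbf x\in\mathrm{Range}(G)$. Let $(\mathbf a_i,y_i)$, $i=1,\dots,m$, be i.i.d. with $\mathbf a_i\sim\mathcal N(\mathbf 0,\mathbf I_n)$ and $y_i=f_i(\mathbf a_i^T\mathbf x)$, where the $f_i$ are i.i.d. copies of an unknown, possibly random, link function, independent of the $\mathbf a_i$. Assume that $y$ is sub-exponential, with norm $K_y:=\sup_{p\ge1}p^{-1}(\mathbb E|y|^p)^{1/p}\in(0,\infty)$, and that $\nu:=\mathrm{Cov}[y,(\mathbf a^T\mathbf x)^2]>0$. Let $\bar y=\frac1m\sum_i y_i$ and let $\zeta>0$ be a step size. From $\mathbf x^{(0)}\in\mathrm{Range}(G)$ define, for $t\ge0$, $$\hat\nu^{(t)}=\frac1m\sum_{i=1}^m(y_i-\bar y)(\mathbf a_i^T\mathbf x^{(t)})^2,\qquad \tilde y_i^{(t)}=(y_i-\bar y)(\mathbf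 a_i^T\mathbf x^{(t)}),$$ $$\tilde{\mathbf x}^{(t+1)}=\mathbf x^{(t)}-\frac\zeta m\sum_{i=1}^m\big(\hat\nu^{(t)}\mathbf a_i^T\mathbf x^{(t)}-\tilde y_i^{(t)}\big)\mathbf a_i,\qquad \mathbf x^{(t+1)}=\mathcal P_G(\tilde{\mathbf x}^{(t+1)}),$$ where $\mathcal P_G(\mathbf s)=G(z)$ for some minimizer $z$ of $\|G(z)-\mathbf s\|_2$ over $B^k(r)$. Write $\kappa=(k\log(nLr))\cdot\log m$. **Theorem.** There is an absolute constant $C_1>0$; for all $\zeta,\nu>0$ there is $C>0$ depending only on $\zeta,\nu$; and for all $K_y,\beta_1,\beta_2>0$ there are $C_0,C_2>0$ depending only on $\zeta,\nu,K_y,\beta_1,\beta_2$, such that in the above setting the following holds whenever $m\ge C_0\,\kappa$. With probability at least $1-C_1/m$, for every $\mathbf x^{(0)}\in\mathrm{Range}(G)$ (possibly depending on the data) with $$2|1-\zeta\nu|+5\zeta\nu\,\|\mathbf x^{(0)}-\mathbf x\|_2+\beta_1\le 1-\beta_2$$ (in particular, with equality) and for every choice of the minimizers in the projections, there is an integer $T_0\ge0$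 with $T_0\le C_2\log(m/\kappa)$ such that $\|\mathbf x^{(t)}-\mathbf x\|_2$ is strictly decreasing on $\{0,\dots,T_0\}$, for all $t\le T_0$ $$\|\mathbf x^{(t)}-\mathbf x\|_2<(1-\beta_2)^t\,\|\mathbf x^{(0)}-\mathbf x\|_2+\frac{CK_y}{\beta_2}\sqrt{\frac{(k\log(nLr))\cdot\log m}{m}},$$ and for all $t\ge T_0$ $$\|\mathbf x^{(t)}-\mathbf x\|_2\le\frac{CK_y}{\beta_2}\sqrt{\frac{(k\log(nLr))\cdot\log m}{m}}.$$ -/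

import Mathlib

open MeasureTheory ProbabilityTheory
open scoped ENNReal NNReal

namespace MPR

/-- Euclidean space `ℝⁿ`. -/
abbrev Vec (n : ℕ) := EuclideanSpace ℝ (Fin n)

/-- The range `G(B^k(r))` of a generative model restricted to the closed ball `B^k(r)`. -/
def genRange {k n : ℕ} (G : Vec k → Vec n) (r : ℝ) : Set (Vec n) :=
  G '' Metric.closedBall 0 r

/-- `G` is an `L`-Lipschitz generative model on `B^k(r)` with values in the unit sphere of `ℝⁿ`.
(The values of `G` outside `B^k(r)` are irrelevant.) -/
structure IsGenModel {k n : ℕ} (G : Vec k → Vec n) (L : ℝ≥0) (r : ℝ) : Prop where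
  radius_pos : 0 < r
  lipschitz : LipschitzOnWith L G (Metric.closedBall 0 r)
  unit_range : ∀ z ∈ Metric.closedBall (0 : Vec k) r, ‖G z‖ = 1

/-- `p` is an exact projection of `s` onto `G(B^k(r))`: `p = G z` for some minimizer `z` of
`‖G z - s‖` over `B^k(r)`. -/
def IsProjection {k n : ℕ} (G : Vec k → Vec n) (r : ℝ) (s p : Vec n) : Prop :=
  ∃ z ∈ Metric.closedBall (0 : Vec k) r,
    (∀ z' ∈ Metric.closedBall (0 : Vec k) r, ‖G z - s‖ ≤ ‖G z' - s‖) ∧ p = G z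

/-- The sub-exponential norm `sup_{p ≥ 1} p⁻¹ (E |X|^p)^{1/p}`, with values in `[0, ∞]`. -/
noncomputable def psiOneNorm {Ω : Type*} [MeasurableSpace Ω] (X : Ω → ℝ) (P : Measure Ω) : ℝ≥0∞ :=
  ⨆ (p : ℝ) (_ : 1 ≤ p), (∫⁻ ω, ‖X ω‖ₑ ^ p ∂P) ^ (1 / p) / ENNReal.ofReal p

/-- `m` i.i.d. copies `(a i, ξ i)` of a pair consisting of a standard Gaussian sensing vector
`a` in `ℝⁿ` and an independent source of randomness `ξ` for the random link function. -/
structure IsDesign {Ω Ξ : Type*} [MeasurableSpace Ω] [MeasurableSpace Ξ] {m n : ℕ}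
    (P : Measure Ω) (a : Fin m → Ω → Vec n) (ξ : Fin m → Ω → Ξ) : Prop where
  measurable_vec : ∀ i, Measurable (a i)
  measurable_noise : ∀ i, Measurable (ξ i)
  gaussian : ∀ i, P.map (a i) = stdGaussian (Vec n)
  noise_identDistrib : ∀ i j, IdentDistrib (ξ i) (ξ j) P P
  noise_indep : ∀ i, IndepFun (a i) (ξ i) P
  indep : iIndepFun (fun i ω => (a i ω, ξ i ω)) P

/-- The observation `y = f(aᵀx)` of the single index model; the random link function is
`t ↦ f t ξ`. -/
noncomputable def observation {Ω Ξ : Type*} {n : ℕ} (f : ℝ → Ξ → ℝ) (x : Vec n)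
    (a : Ω → Vec n) (ξ : Ω → Ξ) (ω : Ω) : ℝ :=
  f (inner ℝ (a ω) x) (ξ ω)

/-- The empirical mean `ȳ`. -/
noncomputable def empMean {m : ℕ} (y : Fin m → ℝ) : ℝ :=
  (1 / (m : ℝ)) * ∑ i, y i

/-- `ν̂ = (1/m) ∑ i, (y i - ȳ) (a iᵀ u)²`, the data-driven scale at the iterate `u`. -/
noncomputable def scaleEst {m n : ℕ} (a : Fin m → Vec n) (y : Fin m → ℝ) (u : Vec n) : ℝ :=
  (1 / (m : ℝ)) * ∑ i, (y i - empMean y) * (inner ℝ (a i) u) ^ 2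

/-- The centered response `(y i - ȳ) (a iᵀ u)`. -/
noncomputable def centeredResponse {m n : ℕ} (a : Fin m → Vec n) (y : Fin m → ℝ) (u : Vec n)
    (i : Fin m) : ℝ :=
  (y i - empMean y) * inner ℝ (a i) u

/-- The gradient step `u - (ζ/m) ∑ i, (ν̂ (a iᵀ u) - ỹ i) a i`. -/
noncomputable def gradStep {m n : ℕ} (ζ : ℝ) (a : Fin m → Vec n) (y : Fin m → ℝ)
    (u : Vec n) : Vec n :=
  u - (ζ / (m : ℝ)) •
    ∑ i, (scaleEst a y u * inner ℝ (a i) u - centeredResponse a y u i) • a i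

/-- `X` is a sequence of iterates of the second step of the algorithm, started at a point of
`G(B^k(r))`: each iterate is an exact projection of the gradient step at the previous one. -/
structure IsSecondStep {k m n : ℕ} (G : Vec k → Vec n) (r ζ : ℝ) (a : Fin m → Vec n)
    (y : Fin m → ℝ) (X : ℕ → Vec n) : Prop where
  init : X 0 ∈ genRange G r
  step : ∀ t, IsProjection G r (gradStep ζ a y (X t)) (X (t + 1))

/-- The complexity term `(k log (nLr)) · log m`. -/
noncomputable def complexity (m n k : ℕ) (L : ℝ≥0) (r : ℝ) : ℝ :=
  (k * Real.log (n * L * r)) * Real.log m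

end MPR

/-!
The iteration contracts the error `‖X t - x‖` up to a statistical error of order
`e = √(κ / m)`, where `κ` is the complexity, and the stopping time `T₀` is the first `t` at which
the error is at most a constant multiple of `e`.

*One step.* Put `v = p - x`, where `p` is the projection of the gradient step at `u`. Minimality of
`p` gives `‖v‖² ≤ 2 ⟪s - x, v⟫` for the gradient step `s`, and the right hand side is expressed by
the empirical bilinear forms with weights `yᵢ - ȳ` and with weights `1` (`inner_gradStep`). Their
expectations are `ν ⟪x, ·⟫ ⟪x, ·⟫` and the inner product. With the expectations in place of the
empirical forms, the step is a contraction by elementary geometry of the sphere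
(`population_step_le_aux`). The deviations enter through `norm_step_le`. The scalar
`(1/m) ∑ (yᵢ - ȳ) (aᵢᵀ x)²` is only a sample mean of variables with heavy tails, and, if the
probability of failure is to be of order `1/m` with an absolute constant, it is `ν` only up to some
fixed `τ`. This is harmless: `⟪x, v⟫ = -‖v‖² / 2` on the sphere, so that `τ` perturbs the
contraction factor, where the margin `β₁` absorbs it, and not the additive error.

*Concentration.* Decompose `aᵢ` into its component along `x` and the orthogonal part
(`orthPart`). The responses, hence the weights `yᵢ - ȳ`, depend only on the former and on the
noise, and both are independent of the latter (`IsDesign.indepFun_orthPart`). Conditionally on them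
the remaining sums are linear and quadratic forms in Gaussian vectors with fixed weights, for which
Bernstein's inequality holds (`measureReal_gt_le_of_linear`, `measureReal_gt_le_of_bilinear`). The
quadratic forms need no centring, as the weights sum to zero. The required bounds on the weights,
such as `max |yᵢ| ≲ K log m`, hold off an event of probability `O(1/m)`, by the sub-exponential
tails and by the fourth moment version of Chebyshev's inequality
(`measureReal_abs_sum_sub_ge_le`).

*Uniformity.* These bounds hold simultaneously for all directions `q` and `q - x` with `q` in a net
of the range of `G` at scale `e² / n`, and extend to all directions by the crude bound of order `n`
for the empirical forms (`abs_empForm_sub_le_of_net`), because vectors `v` of norm less than `e`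
need no bound. The scale is coarse enough for the logarithm `D` of the size of the net to satisfy
`D = O(m e²)` and `D log m = O(m e)` (`log_card_bounds`), which is what Bernstein's inequality with
weights of size `log m` requires to yield deviations of order `e`.
-/

namespace MPR

/-! ### Tails of weighted sums of Gaussian products -/

theorem measureReal_le_add_of_subset_union {Ω : Type*} [MeasurableSpace Ω] {P : Measure Ω}
    [IsFiniteMeasure P] {A B C : Set Ω} {b c : ℝ} (hB : P.real B ≤ b) (hC : P.real C ≤ c)
    (h : A ⊆ B ∪ C) : P.real A ≤ b + c :=
  (measureReal_mono h).trans ((measureReal_union_le _ _).trans (add_le_add hB hC))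

/-- Chernoff's bound for a sum of independent variables. -/
theorem measureReal_sum_ge_le_of_mgf_le {Ω ι : Type*} [MeasurableSpace Ω] [Fintype ι]
    {P : Measure Ω} [IsProbabilityMeasure P] {X : ι → Ω → ℝ} (hind : iIndepFun X P)
    (hm : ∀ i, Measurable (X i)) {l : ℝ} (hl : 0 ≤ l)
    (hint : ∀ i, Integrable (fun ω => Real.exp (l * X i ω)) P) {v : ι → ℝ}
    (hv : ∀ i, mgf (X i) P l ≤ Real.exp (v i)) (t : ℝ) :
    P.real {ω | t ≤ ∑ i, X i ω} ≤ Real.exp (∑ i, v i - l * t) := by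
  have h1 := measure_ge_le_exp_mul_mgf (μ := P) (X := ∑ i, X i) t hl
    (hind.integrable_exp_mul_sum hm (fun i _ => hint i))
  simp only [Finset.sum_apply] at h1
  refine h1.trans ?_
  rw [hind.mgf_sum hm, sub_eq_neg_add, Real.exp_add, Real.exp_sum, neg_mul]
  gcongr with i
  · exact fun i _ => mgf_nonneg
  · exact hv i

theorem map_inner_stdGaussian {n : ℕ} (q : Vec n) :
    (stdGaussian (Vec n)).map (fun b => inner ℝ b q) = gaussianReal 0 (‖q‖₊ ^ 2) := by
  apply Measure.ext_of_charFun
  ext t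
  rw [charFun_gaussianReal, charFun_apply_real, integral_map (by fun_prop) (by fun_prop)]
  have := charFun_stdGaussian (E := Vec n) (t • q)
  rw [charFun_apply] at this
  simp only [inner_smul_right] at this
  push_cast at this ⊢
  have h2 : ‖t • q‖ ^ 2 = t ^ 2 * ‖q‖ ^ 2 := by rw [norm_smul, mul_pow]; simp
  rw [this, ← Complex.ofReal_pow ‖t • q‖, h2]
  congr 1
  push_cast
  simp
  ring

/-- The inequality `-log (1 - x) ≤ x + x²`, in exponential form. -/
theorem neg_log_one_sub_le_aux {x : ℝ} (h1 : -(1 / 2) ≤ x) (h2 : x ≤ 1 / 2) :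
    1 ≤ (1 - x) * Real.exp (x + x ^ 2) := by
  rcases le_or_gt 0 x with hx | hx
  · have h := Real.quadratic_le_exp_of_nonneg (x := x + x ^ 2) (by positivity)
    have h3 : (1 - x) * (1 + (x + x ^ 2) + (x + x ^ 2) ^ 2 / 2) ≤ (1 - x) * Real.exp (x + x ^ 2) :=
      mul_le_mul_of_nonneg_left h (by linarith)
    have h4 : 0 ≤ x ^ 2 * ((1 - x) * (1 + x) ^ 2 / 2 - x) := by
      apply mul_nonneg (sq_nonneg _)
      nlinarith [mul_nonneg hx (sub_nonneg.2 h2), mul_nonneg (mul_nonneg hx hx) (sub_nonneg.2 h2)]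
    nlinarith
  · have h := Real.add_one_le_exp (x + x ^ 2)
    have h3 : (1 - x) * (x + x ^ 2 + 1) ≤ (1 - x) * Real.exp (x + x ^ 2) :=
      mul_le_mul_of_nonneg_left h (by linarith)
    nlinarith [mul_pos_of_neg_of_neg hx hx]

theorem integrable_exp_mul_sq_gaussianReal {s : ℝ} (hs : s < 1 / 2) :
    Integrable (fun t => Real.exp (s * t ^ 2)) (gaussianReal 0 1) := by
  rw [gaussianReal_of_var_ne_zero _ one_ne_zero,
    integrable_withDensity_iff_integrable_smul₀' (by fun_prop)
      (Filter.Eventually.of_forall fun _ => gaussianPDF_lt_top)]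
  have := (integrable_exp_neg_mul_sq (b := 1 / 2 - s) (by linarith)).const_mul
    (√(2 * Real.pi))⁻¹
  refine this.congr (Filter.Eventually.of_forall fun t => ?_)
  beta_reduce
  rw [toReal_gaussianPDF]
  simp only [gaussianPDFReal, smul_eq_mul, NNReal.coe_one, mul_one, sub_zero]
  rw [mul_assoc, ← Real.exp_add]
  congr 2
  ring

theorem integral_exp_mul_sq_gaussianReal {s : ℝ} (hs : s < 1 / 2) :
    ∫ t, Real.exp (s * t ^ 2) ∂(gaussianReal 0 1) = (√(1 - 2 * s))⁻¹ := by
  rw [integral_gaussianReal_eq_integral_smul one_ne_zero]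
  have hpdf : ∀ t : ℝ, gaussianPDFReal 0 1 t • Real.exp (s * t ^ 2) =
      (√(2 * Real.pi))⁻¹ * Real.exp (-(1 / 2 - s) * t ^ 2) := by
    intro t
    simp only [gaussianPDFReal, smul_eq_mul, NNReal.coe_one, mul_one, sub_zero]
    rw [mul_assoc, ← Real.exp_add]
    congr 2
    ring
  rw [integral_congr_ae (Filter.Eventually.of_forall hpdf)]
  rw [integral_const_mul, integral_gaussian, ← Real.sqrt_inv, ← Real.sqrt_inv, ← Real.sqrt_mul]
  · congr 1
    have := Real.pi_pos
    have : 1 - 2 * s ≠ 0 := by linarith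
    have : 1 / 2 - s ≠ 0 := by linarith
    field_simp
  · have := Real.pi_pos
    positivity

/-- The centred square of a standard Gaussian variable has a sub-Gaussian moment generating
function on `[-1/4, 1/4]`. -/
theorem integral_exp_mul_sq_sub_one_le {s : ℝ} (hs : |s| ≤ 1 / 4) :
    ∫ t, Real.exp (s * (t ^ 2 - 1)) ∂(gaussianReal 0 1) ≤ Real.exp (2 * s ^ 2) := by
  have hs' := abs_le.1 hs
  have h0 : 0 < 1 - 2 * s := by linarith
  have hsplit : ∀ t : ℝ, Real.exp (s * (t ^ 2 - 1)) = Real.exp (-s) * Real.exp (s * t ^ 2) := by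
    intro t; rw [← Real.exp_add]; congr 1; ring
  simp only [hsplit]
  rw [integral_const_mul, integral_exp_mul_sq_gaussianReal (by linarith)]
  have h1 := neg_log_one_sub_le_aux (x := 2 * s) (by linarith) (by linarith)
  rw [← div_eq_mul_inv, div_le_iff₀ (by positivity)]
  have h2 : Real.exp (-s) = Real.exp (2 * s ^ 2) * Real.exp (-(s + 2 * s ^ 2)) := by
    rw [← Real.exp_add]; congr 1; ring
  rw [h2]
  gcongr
  apply Real.le_sqrt_of_sq_le
  rw [← Real.exp_nat_mul, ← mul_le_mul_iff_left₀ (Real.exp_pos (2 * s + (2 * s) ^ 2)),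
    ← Real.exp_add]
  refine le_trans (le_of_eq ?_) h1
  rw [Real.exp_eq_one_iff]
  push_cast; ring

theorem map_inner_eq_gaussianReal {Ω : Type*} [MeasurableSpace Ω] {P : Measure Ω}
    {n : ℕ} {b : Ω → Vec n} (hm : Measurable b)
    (hb : P.map b = stdGaussian (Vec n)) (q : Vec n) :
    P.map (fun ω => inner ℝ (b ω) q) = gaussianReal 0 (‖q‖₊ ^ 2) := by
  rw [← map_inner_stdGaussian, ← hb, Measure.map_map (by fun_prop) hm]
  rfl

theorem map_inner_eq_map_mul {Ω : Type*} [MeasurableSpace Ω] {P : Measure Ω}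
    {n : ℕ} {b : Ω → Vec n} (hm : Measurable b)
    (hb : P.map b = stdGaussian (Vec n)) (q : Vec n) :
    P.map (fun ω => inner ℝ (b ω) q) = (gaussianReal 0 1).map (‖q‖ * ·) := by
  rw [map_inner_eq_gaussianReal hm hb, gaussianReal_map_const_mul]
  congr 1
  · simp
  · ext; simp

section
variable {Ω : Type*} [MeasurableSpace Ω] {P : Measure Ω} [IsProbabilityMeasure P] {m n : ℕ}
  {a : Fin m → Ω → Vec n}

/-- Gaussian tail of a linear form with fixed coefficients. -/
theorem measureReal_gt_le_of_linear (hind : iIndepFun a P) (hm : ∀ i, Measurable (a i))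
    (hg : ∀ i, P.map (a i) = stdGaussian (Vec n)) (b : Fin m → ℝ) {V D : ℝ} (hV : 0 < V)
    (hD : 0 ≤ D) (hb : ∑ i, b i ^ 2 ≤ V) (q : Vec n) :
    P.real {ω | √(2 * V * D) * ‖q‖ < ∑ i, b i * inner ℝ (a i ω) q} ≤ Real.exp (-D) := by
  rcases eq_or_ne q 0 with rfl | hq
  · simp [Real.exp_nonneg]
  have hq' : 0 < ‖q‖ := norm_pos_iff.2 hq
  have hmq : ∀ i, Measurable (fun ω => b i * inner ℝ (a i ω) q) := fun i => by
    have := hm i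
    fun_prop
  set l : ℝ := √(2 * V * D) / (V * ‖q‖) with hl
  have h := measureReal_sum_ge_le_of_mgf_le (P := P) (X := fun i ω => b i * inner ℝ (a i ω) q)
    (hind.comp (fun i z => b i * inner ℝ z q) (fun i => by fun_prop)) hmq (l := l)
    (by positivity) (v := fun i => (b i) ^ 2 * (‖q‖ ^ 2 * l ^ 2 / 2)) ?_ ?_ (√(2 * V * D) * ‖q‖)
  · refine (measureReal_mono ?_).trans (h.trans ?_)
    · intro ω hω
      exact (Set.mem_ofPred_eq ▸ hω : _ < _).le
    · apply Real.exp_le_exp.2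
      rw [← Finset.sum_mul]
      have h1 : (∑ i, b i ^ 2) * (‖q‖ ^ 2 * l ^ 2 / 2) ≤ V * (‖q‖ ^ 2 * l ^ 2 / 2) := by gcongr
      have h2 : V * (‖q‖ ^ 2 * l ^ 2 / 2) = D := by
        rw [hl, div_pow, Real.sq_sqrt (by positivity)]
        field_simp
      have h3 : l * (√(2 * V * D) * ‖q‖) = 2 * D := by
        rw [hl]
        have : √(2 * V * D) * √(2 * V * D) = 2 * V * D := Real.mul_self_sqrt (by positivity)
        field_simp
        linarith
      linarith
  · intro i
    have : Integrable (fun t => Real.exp ((l * b i) * t)) (P.map (fun ω => inner ℝ (a i ω) q)) := by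
      rw [map_inner_eq_gaussianReal (hm i) (hg i)]
      exact integrable_exp_mul_gaussianReal _
    have h2 := this.comp_measurable (by have := hm i; fun_prop)
    refine h2.congr (Filter.Eventually.of_forall fun ω => ?_)
    simp [mul_assoc]
  · intro i
    rw [mgf_const_mul, mgf_gaussianReal (map_inner_eq_gaussianReal (hm i) (hg i) q)]
    apply Real.exp_le_exp.2
    simp only [zero_mul, zero_add, NNReal.coe_pow, coe_nnnorm]
    apply le_of_eq; ring

/-- Chernoff's bound for weighted sums of centred squares of Gaussian variables, at a parameter `l`
which is admissible for the weights. -/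
theorem measureReal_ge_le_of_sq (hind : iIndepFun a P) (hm : ∀ i, Measurable (a i))
    (hg : ∀ i, P.map (a i) = stdGaussian (Vec n)) (w : Fin m → ℝ) {l t : ℝ} (hl : 0 ≤ l)
    (hw : ∀ i, l * |w i| ≤ 1 / 4) (q : Vec n) (hq : ‖q‖ ≤ 1) :
    P.real {ω | t ≤ ∑ i, w i * (inner ℝ (a i ω) q ^ 2 - ‖q‖ ^ 2)} ≤
      Real.exp (2 * l ^ 2 * ∑ i, w i ^ 2 - l * t) := by
  have hs : ∀ i, |l * w i * ‖q‖ ^ 2| ≤ 1 / 4 := fun i => by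
    rw [abs_mul, abs_mul, abs_of_nonneg hl, abs_of_nonneg (sq_nonneg ‖q‖)]
    have : ‖q‖ ^ 2 ≤ 1 := pow_le_one₀ (norm_nonneg _) hq
    calc _ ≤ l * |w i| * 1 := by gcongr
      _ ≤ _ := by simpa using hw i
  have key : ∀ i s, Real.exp (l * (w i * ((‖q‖ * s) ^ 2 - ‖q‖ ^ 2))) =
      Real.exp ((l * w i * ‖q‖ ^ 2) * (s ^ 2 - 1)) := fun i s => by congr 1; ring
  rw [Finset.mul_sum]
  refine measureReal_sum_ge_le_of_mgf_le (P := P)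
    (X := fun i ω => w i * (inner ℝ (a i ω) q ^ 2 - ‖q‖ ^ 2))
    (hind.comp (fun i z => w i * (inner ℝ z q ^ 2 - ‖q‖ ^ 2)) (fun i => by fun_prop))
    (fun i => by have := hm i; fun_prop) hl
    (v := fun i => 2 * l ^ 2 * w i ^ 2) ?_ ?_ t
  · intro i
    have : Integrable (fun t => Real.exp (l * (w i * (t ^ 2 - ‖q‖ ^ 2))))
        (P.map (fun ω => inner ℝ (a i ω) q)) := by
      rw [map_inner_eq_map_mul (hm i) (hg i), integrable_map_measure (by fun_prop) (by fun_prop)]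
      simp only [Function.comp_def, key]
      have h1 := (integrable_exp_mul_sq_gaussianReal (s := l * w i * ‖q‖ ^ 2)
        (by linarith [(abs_le.1 (hs i)).2])).const_mul (Real.exp (-(l * w i * ‖q‖ ^ 2)))
      refine h1.congr (Filter.Eventually.of_forall fun s => ?_)
      simp only
      rw [← Real.exp_add]; congr 1; ring
    exact this.comp_measurable (by have := hm i; fun_prop)
  · intro i
    rw [mgf, ← integral_map (φ := fun ω => inner ℝ (a i ω) q)
      (f := fun t => Real.exp (l * (w i * (t ^ 2 - ‖q‖ ^ 2))))
      (by have := hm i; fun_prop) (by fun_prop),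
      map_inner_eq_map_mul (hm i) (hg i), integral_map (by fun_prop) (by fun_prop)]
    simp only [key]
    refine (integral_exp_mul_sq_sub_one_le (hs i)).trans (Real.exp_le_exp.2 ?_)
    have : ‖q‖ ^ 4 ≤ 1 := pow_le_one₀ (norm_nonneg _) hq
    have h3 : 2 * (l * w i * ‖q‖ ^ 2) ^ 2 = 2 * l ^ 2 * w i ^ 2 * ‖q‖ ^ 4 := by ring
    rw [h3]
    exact mul_le_of_le_one_right (by positivity) this

/-- Bernstein's inequality for weighted sums of products of Gaussian coordinates; it is reduced to
squares by polarization. -/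
theorem measureReal_gt_le_of_bilinear_of_norm_le_one (hind : iIndepFun a P)
    (hm : ∀ i, Measurable (a i))
    (hg : ∀ i, P.map (a i) = stdGaussian (Vec n)) (w : Fin m → ℝ) {V B D : ℝ} (hV : 0 < V)
    (hB : 0 < B) (hD : 0 ≤ D) (hwV : ∑ i, w i ^ 2 ≤ V) (hwB : ∀ i, |w i| ≤ B)
    (u v : Vec n) (hu : ‖u‖ ≤ 1) (hv : ‖v‖ ≤ 1) :
    P.real {ω | 6 * √(V * D) + 24 * B * D <
      ∑ i, w i * (inner ℝ (a i ω) u * inner ℝ (a i ω) v - inner ℝ u v)} ≤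
      2 * Real.exp (-D) := by
  -- The Chernoff parameter is the unconstrained optimum when that is admissible, and the largest
  -- admissible value otherwise.
  obtain ⟨l, hl, hlB, hlt⟩ : ∃ l : ℝ, 0 ≤ l ∧ l * B ≤ 1 / 4 ∧
      2 * l ^ 2 * V - l * (3 * √(V * D) + 12 * B * D) ≤ -D := by
    have hsq : √(V * D) = √V * √D := Real.sqrt_mul hV.le _
    have hVV : √V * √V = V := Real.mul_self_sqrt hV.le
    have hDD : √D * √D = D := Real.mul_self_sqrt hD
    have hV' : 0 < √V := Real.sqrt_pos.2 hV
    have hD' : 0 ≤ √D := Real.sqrt_nonneg _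
    by_cases h : √D / √V * B ≤ 1 / 4
    · refine ⟨√D / √V, by positivity, h, ?_⟩
      have e1 : (√D / √V) ^ 2 * V = D := by
        rw [div_pow, Real.sq_sqrt hV.le, Real.sq_sqrt hD]; field_simp
      have e2 : √D / √V * √(V * D) = D := by
        rw [hsq]; field_simp; linarith
      have e3 : 0 ≤ √D / √V * (12 * B * D) := by positivity
      nlinarith
    · push Not at h
      refine ⟨1 / (4 * B), by positivity, by field_simp; norm_num, ?_⟩
      have h1 : √V < 4 * (√D * B) := by
        rw [div_mul_eq_mul_div, lt_div_iff₀ hV'] at h; linarith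
      have h2 : V ≤ 16 * (D * B ^ 2) := by
        nlinarith [mul_self_le_mul_self hV'.le h1.le]
      have e1 : 2 * (1 / (4 * B)) ^ 2 * V ≤ 2 * D := by
        have : 2 * (1 / (4 * B)) ^ 2 * V = V / (8 * B ^ 2) := by field_simp; norm_num
        rw [this, div_le_iff₀ (by positivity)]
        linarith
      have e2 : 1 / (4 * B) * (12 * B * D) = 3 * D := by field_simp; ring
      have e3 : 0 ≤ 1 / (4 * B) * (3 * √(V * D)) := by positivity
      nlinarith
  set T := 3 * √(V * D) + 12 * B * D with hT
  have hn1 : ‖(1 / 2 : ℝ) • (u + v)‖ ≤ 1 := by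
    rw [norm_smul]; norm_num
    linarith [norm_add_le u v]
  have hn2 : ‖(1 / 2 : ℝ) • (u - v)‖ ≤ 1 := by
    rw [norm_smul]; norm_num
    linarith [norm_sub_le u v]
  have h1 := measureReal_ge_le_of_sq hind hm hg w (t := T) hl
    (fun i => by calc _ ≤ l * B := by gcongr; exact hwB i
                   _ ≤ _ := hlB) _ hn1
  have h2 := measureReal_ge_le_of_sq hind hm hg (fun i => - w i) (t := T) hl
    (fun i => by rw [abs_neg]
                 calc _ ≤ l * B := by gcongr; exact hwB i
                   _ ≤ _ := hlB) _ hn2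
  have hexp : Real.exp (2 * l ^ 2 * ∑ i, w i ^ 2 - l * T) ≤ Real.exp (-D) := by
    apply Real.exp_le_exp.2
    have : 2 * l ^ 2 * ∑ i, w i ^ 2 ≤ 2 * l ^ 2 * V := by gcongr
    linarith
  simp only [neg_sq] at h2
  refine (measureReal_le_add_of_subset_union (h1.trans hexp) (h2.trans hexp) ?_).trans_eq
    (by ring)
  intro ω hω
  simp only [Set.mem_ofPred_eq, Set.mem_union] at hω ⊢
  by_contra! hcon
  have hpol : ∀ i, w i * (inner ℝ (a i ω) u * inner ℝ (a i ω) v - inner ℝ u v) =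
      w i * (inner ℝ (a i ω) ((1 / 2 : ℝ) • (u + v)) ^ 2 - ‖(1 / 2 : ℝ) • (u + v)‖ ^ 2) +
      -w i * (inner ℝ (a i ω) ((1 / 2 : ℝ) • (u - v)) ^ 2 - ‖(1 / 2 : ℝ) • (u - v)‖ ^ 2) := by
    intro i
    simp only [norm_smul, mul_pow, norm_add_sq_real, norm_sub_sq_real, inner_smul_right,
      inner_add_right, inner_sub_right]
    norm_num
    ring
  rw [Finset.sum_congr rfl fun i _ => hpol i, Finset.sum_add_distrib] at hω
  linarith [hcon.1, hcon.2]

theorem measureReal_gt_le_of_bilinear (hind : iIndepFun a P)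
    (hm : ∀ i, Measurable (a i))
    (hg : ∀ i, P.map (a i) = stdGaussian (Vec n)) (w : Fin m → ℝ) {V B D : ℝ} (hV : 0 < V)
    (hB : 0 < B) (hD : 0 ≤ D) (hwV : ∑ i, w i ^ 2 ≤ V) (hwB : ∀ i, |w i| ≤ B)
    (u v : Vec n) :
    P.real {ω | (6 * √(V * D) + 24 * B * D) * (‖u‖ * ‖v‖) <
      |∑ i, w i * (inner ℝ (a i ω) u * inner ℝ (a i ω) v - inner ℝ u v)|} ≤
      4 * Real.exp (-D) := by
  rcases eq_or_ne u 0 with rfl | hu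
  · simp [Real.exp_nonneg]
  rcases eq_or_ne v 0 with rfl | hv
  · simp [Real.exp_nonneg]
  have hu' : 0 < ‖u‖ := norm_pos_iff.2 hu
  have hv' : 0 < ‖v‖ := norm_pos_iff.2 hv
  have hnu : ‖‖u‖⁻¹ • u‖ ≤ 1 := by rw [norm_smul]; simp [hu]
  have hnv : ‖‖v‖⁻¹ • v‖ ≤ 1 := by rw [norm_smul]; simp [hv]
  have h1 := measureReal_gt_le_of_bilinear_of_norm_le_one hind hm hg w hV hB hD hwV hwB _ _ hnu hnv
  have h2 := measureReal_gt_le_of_bilinear_of_norm_le_one hind hm hg (fun i => -w i) hV hB hD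
    (by simpa using hwV) (by simpa using hwB) _ _ hnu hnv
  refine (measureReal_le_add_of_subset_union h1 h2 ?_).trans_eq (by ring)
  intro ω hω
  simp only [Set.mem_ofPred_eq, Set.mem_union] at hω ⊢
  have e : ∀ i, w i * (inner ℝ (a i ω) (‖u‖⁻¹ • u) * inner ℝ (a i ω) (‖v‖⁻¹ • v) -
      inner ℝ (‖u‖⁻¹ • u) (‖v‖⁻¹ • v)) =
      (w i * (inner ℝ (a i ω) u * inner ℝ (a i ω) v - inner ℝ u v)) / (‖u‖ * ‖v‖) := by
    intro i
    simp only [inner_smul_right, real_inner_smul_left]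
    field_simp
  simp only [neg_mul, Finset.sum_neg_distrib, e, ← Finset.sum_div]
  rw [lt_abs] at hω
  rw [lt_div_iff₀ (by positivity), ← neg_div, lt_div_iff₀ (by positivity)]
  exact hω

end

/-! ### Fourth moments of sums of independent variables -/

section
variable {Ω : Type*} [MeasurableSpace Ω] {P : Measure Ω} [IsProbabilityMeasure P]

theorem integrable_pow_of_integrable_pow {X : Ω → ℝ} (hm : Measurable X) {N j : ℕ} (hj : j ≤ N)
    (hN : Even N) (hX : Integrable (fun ω => X ω ^ N) P) : Integrable (fun ω => X ω ^ j) P := by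
  refine (hX.add (integrable_const (1 : ℝ))).mono' (by fun_prop)
    (Filter.Eventually.of_forall fun ω => ?_)
  rw [Real.norm_eq_abs, abs_pow, Pi.add_apply, ← hN.pow_abs]
  rcases le_total |X ω| 1 with h | h
  · have := pow_le_one₀ (abs_nonneg (X ω)) h (n := j)
    have : 0 ≤ |X ω| ^ N := by positivity
    linarith
  · have := pow_le_pow_right₀ h hj
    linarith

theorem sq_integral_le_integral_sq {X : Ω → ℝ} (hm : Measurable X)
    (hX : Integrable (fun ω => X ω ^ 2) P) : (∫ ω, X ω ∂P) ^ 2 ≤ ∫ ω, X ω ^ 2 ∂P := by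
  have h := variance_nonneg X P
  rw [variance_eq_sub ((memLp_two_iff_integrable_sq hm.aestronglyMeasurable).2 hX)] at h
  simpa using h

theorem integrable_sum_pow_four {ι : Type*} {X : ι → Ω → ℝ} (hm : ∀ i, Measurable (X i))
    (hX : ∀ i, Integrable (fun ω => X i ω ^ 4) P) (s : Finset ι) :
    Integrable (fun ω => (∑ i ∈ s, X i ω) ^ 4) P := by
  classical
  induction s using Finset.induction_on with
  | empty => simp
  | insert i s hi ih =>
    refine ((ih.add (hX i)).const_mul 8).mono' (by fun_prop)
      (Filter.Eventually.of_forall fun ω => ?_)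
    rw [Finset.sum_insert hi, Real.norm_eq_abs, abs_of_nonneg (by positivity), Pi.add_apply]
    nlinarith [sq_nonneg (X i ω - ∑ i ∈ s, X i ω), sq_nonneg (X i ω + ∑ i ∈ s, X i ω),
      sq_nonneg (X i ω ^ 2 - (∑ i ∈ s, X i ω) ^ 2)]

/-- Second and fourth moments of a sum of independent centred variables. Only the squares of the
second moments and the fourth moments survive in the expansion, which gives the order `m²`. -/
theorem integral_sum_pow_four_le {ι : Type*} {X : ι → Ω → ℝ} (hind : iIndepFun X P)
    (hm : ∀ i, Measurable (X i)) (hX : ∀ i, Integrable (fun ω => X i ω ^ 4) P)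
    (h0 : ∀ i, ∫ ω, X i ω ∂P = 0) {K : ℝ} (hK : ∀ i, ∫ ω, X i ω ^ 4 ∂P ≤ K ^ 2) (hK0 : 0 ≤ K)
    (s : Finset ι) :
    ∫ ω, (∑ i ∈ s, X i ω) ^ 4 ∂P ≤ 3 * (s.card : ℝ) ^ 2 * K ^ 2 ∧
      ∫ ω, (∑ i ∈ s, X i ω) ^ 2 ∂P ≤ s.card * K := by
  classical
  induction s using Finset.induction_on with
  | empty => simp
  | insert i s hi ih =>
    set S : Ω → ℝ := fun ω => ∑ i ∈ s, X i ω with hS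
    have hSm : Measurable S := by fun_prop
    have hS4 := integrable_sum_pow_four hm hX s
    have hindS : IndepFun S (X i) P := by
      have := hind.indepFun_finsetSum_of_notMem hm hi
      convert this using 1
      ext ω; simp [hS]
    have hSp : ∀ j ≤ 4, Integrable (fun ω => S ω ^ j) P := fun j hj =>
      integrable_pow_of_integrable_pow hSm hj (by decide) hS4
    have hXp : ∀ j ≤ 4, Integrable (fun ω => X i ω ^ j) P := fun j hj =>
      integrable_pow_of_integrable_pow (hm i) hj (by decide) (hX i)
    have hindp : ∀ j l : ℕ, IndepFun (fun ω => S ω ^ j) (fun ω => X i ω ^ l) P := fun j l =>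
      hindS.comp (φ := fun x => x ^ j) (ψ := fun x => x ^ l) (by fun_prop) (by fun_prop)
    have hint : ∀ j ≤ 4, ∀ l ≤ 4, Integrable (fun ω => S ω ^ j * X i ω ^ l) P :=
      fun j hj l hl => (hindp j l).integrable_mul (hSp j hj) (hXp l hl)
    have hprod : ∀ j l : ℕ, ∫ ω, S ω ^ j * X i ω ^ l ∂P =
        (∫ ω, S ω ^ j ∂P) * ∫ ω, X i ω ^ l ∂P := fun j l =>
      (hindp j l).integral_fun_mul_eq_mul_integral (by fun_prop)
        (by have := hm i; fun_prop)
    have hX1 : ∫ ω, X i ω ^ 1 ∂P = 0 := by simpa using h0 i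
    have hS1 : ∫ ω, S ω ^ 1 ∂P = 0 := by
      simp only [pow_one, hS]
      rw [integral_finsetSum _ fun j _ => by
        simpa using integrable_pow_of_integrable_pow (N := 4) (j := 1) (hm j) (by norm_num)
          (by decide) (hX j)]
      simp [h0]
    have hX2 : ∫ ω, X i ω ^ 2 ∂P ≤ K := by
      have h := sq_integral_le_integral_sq (P := P) (X := fun ω => X i ω ^ 2)
        (by have := hm i; fun_prop) (by simpa [← pow_mul] using hX i)
      simp only [← pow_mul] at h
      exact abs_le_of_sq_le_sq' (h.trans (hK i)) hK0 |>.2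
    have hX20 : 0 ≤ ∫ ω, X i ω ^ 2 ∂P := integral_nonneg fun ω => by positivity
    have hS20 : 0 ≤ ∫ ω, S ω ^ 2 ∂P := integral_nonneg fun ω => by positivity
    have e4 : ∫ ω, (S ω + X i ω) ^ 4 ∂P = ∫ ω, S ω ^ 4 ∂P +
        6 * ((∫ ω, S ω ^ 2 ∂P) * ∫ ω, X i ω ^ 2 ∂P) + ∫ ω, X i ω ^ 4 ∂P := by
      have : ∀ ω, (S ω + X i ω) ^ 4 = S ω ^ 4 + 4 * (S ω ^ 3 * X i ω ^ 1) +
          6 * (S ω ^ 2 * X i ω ^ 2) + 4 * (S ω ^ 1 * X i ω ^ 3) + X i ω ^ 4 := fun ω => by ring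
      simp only [this]
      rw [integral_add (by
          exact (((hS4.add ((hint 3 (by norm_num) 1 (by norm_num)).const_mul 4)).add
            ((hint 2 (by norm_num) 2 (by norm_num)).const_mul 6)).add
            ((hint 1 (by norm_num) 3 (by norm_num)).const_mul 4))) (hX i),
        integral_add (by
          exact ((hS4.add ((hint 3 (by norm_num) 1 (by norm_num)).const_mul 4)).add
            ((hint 2 (by norm_num) 2 (by norm_num)).const_mul 6)))
            ((hint 1 (by norm_num) 3 (by norm_num)).const_mul 4),
        integral_add (by exact hS4.add ((hint 3 (by norm_num) 1 (by norm_num)).const_mul 4))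
            ((hint 2 (by norm_num) 2 (by norm_num)).const_mul 6),
        integral_add hS4 ((hint 3 (by norm_num) 1 (by norm_num)).const_mul 4),
        integral_const_mul, integral_const_mul, integral_const_mul, hprod, hprod, hprod, hX1, hS1]
      ring
    have e2 : ∫ ω, (S ω + X i ω) ^ 2 ∂P = ∫ ω, S ω ^ 2 ∂P + ∫ ω, X i ω ^ 2 ∂P := by
      have : ∀ ω, (S ω + X i ω) ^ 2 = S ω ^ 2 + 2 * (S ω ^ 1 * X i ω ^ 1) + X i ω ^ 2 :=
        fun ω => by ring
      simp only [this]
      rw [integral_add (by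
          exact (hSp 2 (by norm_num)).add ((hint 1 (by norm_num) 1 (by norm_num)).const_mul 2))
          (hXp 2 (by norm_num)),
        integral_add (hSp 2 (by norm_num)) ((hint 1 (by norm_num) 1 (by norm_num)).const_mul 2),
        integral_const_mul, hprod, hX1]
      ring
    have hsum : ∀ ω, ∑ j ∈ insert i s, X j ω = S ω + X i ω := fun ω => by
      rw [Finset.sum_insert hi, add_comm]
    simp only [hsum, Finset.card_insert_of_notMem hi]
    rw [e4, e2]
    push_cast
    constructor
    · have h1 : (∫ ω, S ω ^ 2 ∂P) * ∫ ω, X i ω ^ 2 ∂P ≤ (s.card * K) * K :=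
        mul_le_mul ih.2 hX2 hX20 (by positivity)
      nlinarith [ih.1, hK i, sq_nonneg K]
    · linarith [ih.2]

theorem pow_four_integral_le {Z : Ω → ℝ} (hm : Measurable Z)
    (hZ : Integrable (fun ω => Z ω ^ 4) P) : (∫ ω, Z ω ∂P) ^ 4 ≤ ∫ ω, Z ω ^ 4 ∂P := by
  have h1 := sq_integral_le_integral_sq hm (integrable_pow_of_integrable_pow hm (j := 2)
    (by norm_num) (by decide) hZ)
  have h2 := sq_integral_le_integral_sq (P := P) (X := fun ω => Z ω ^ 2) (by fun_prop)
    (by simpa [← pow_mul] using hZ)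
  simp only [← pow_mul] at h2
  calc (∫ ω, Z ω ∂P) ^ 4 = ((∫ ω, Z ω ∂P) ^ 2) ^ 2 := by ring
    _ ≤ (∫ ω, Z ω ^ 2 ∂P) ^ 2 := by gcongr
    _ ≤ _ := h2

theorem abs_integral_le_of_pow_four {Z : Ω → ℝ} (hm : Measurable Z)
    (hZ : Integrable (fun ω => Z ω ^ 4) P) {B : ℝ} (hB : 0 ≤ B)
    (hZB : ∫ ω, Z ω ^ 4 ∂P ≤ B ^ 4) : |∫ ω, Z ω ∂P| ≤ B := by
  have := (pow_four_integral_le hm hZ).trans hZB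
  have h := abs_nonneg (∫ ω, Z ω ∂P)
  rw [← (by decide : Even 4).pow_abs] at this
  exact le_of_pow_le_pow_left₀ (by norm_num) hB this

/-- The fourth moment version of Chebyshev's inequality for sample means. Its bound is of order
`m⁻²`, so that the dependence on the moments can be absorbed by one factor `m⁻¹`. -/
theorem measureReal_abs_sum_sub_ge_le {m : ℕ} (hm0 : 1 ≤ m) {Z : Fin m → Ω → ℝ}
    (hind : iIndepFun Z P) (hm : ∀ i, Measurable (Z i))
    (hZ : ∀ i, Integrable (fun ω => Z i ω ^ 4) P) {μ B : ℝ} (hμ : ∀ i, ∫ ω, Z i ω ∂P = μ)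
    (hZB : ∀ i, ∫ ω, Z i ω ^ 4 ∂P ≤ B ^ 4) {t : ℝ} (ht : 0 < t) :
    P.real {ω | t ≤ |(1 / (m : ℝ)) * ∑ i, Z i ω - μ|} ≤ 48 * (B / t) ^ 4 / m ^ 2 := by
  have hmpos : (0 : ℝ) < m := by exact_mod_cast hm0
  have hZ1 : ∀ i, Integrable (Z i) P := fun i => by
    simpa using integrable_pow_of_integrable_pow (hm i) (j := 1) (N := 4) (by norm_num)
      (by decide) (hZ i)
  have hconv : ∀ i ω, (Z i ω - μ) ^ 4 ≤ 8 * (Z i ω ^ 4 + μ ^ 4) := fun i ω => by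
    nlinarith [sq_nonneg (Z i ω - μ), sq_nonneg (Z i ω + μ), sq_nonneg (Z i ω ^ 2 - μ ^ 2)]
  have hint : ∀ i, Integrable (fun ω => 8 * (Z i ω ^ 4 + μ ^ 4)) P := fun i =>
    ((hZ i).add (integrable_const _)).const_mul 8
  have hX4 : ∀ i, Integrable (fun ω => (Z i ω - μ) ^ 4) P := fun i => by
    refine (hint i).mono' (by have := hm i; fun_prop) (Filter.Eventually.of_forall fun ω => ?_)
    rw [Real.norm_eq_abs, abs_of_nonneg (by positivity)]
    exact hconv i ω
  have hK : ∀ i, ∫ ω, (Z i ω - μ) ^ 4 ∂P ≤ (4 * B ^ 2) ^ 2 := fun i => by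
    have h1 := integral_mono (hX4 i) (hint i) (hconv i)
    rw [integral_const_mul, integral_add (hZ i) (integrable_const _)] at h1
    have h2 := pow_four_integral_le (hm i) (hZ i)
    rw [hμ i] at h2
    simp only [integral_const, probReal_univ, smul_eq_mul, one_mul] at h1
    nlinarith [hZB i]
  have hmean : ∀ i, ∫ ω, (Z i ω - μ) ∂P = 0 := fun i => by
    rw [integral_sub (hZ1 i) (integrable_const _), hμ i]; simp
  have hind' : iIndepFun (fun i ω => Z i ω - μ) P :=
    hind.comp (fun _ x => x - μ) (fun _ => by fun_prop)
  have key := (integral_sum_pow_four_le hind' (fun i => by have := hm i; fun_prop) hX4 hmean hK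
    (by positivity) Finset.univ).1
  have hint4 := integrable_sum_pow_four (P := P) (X := fun i ω => Z i ω - μ)
    (fun i => by have := hm i; fun_prop) hX4 Finset.univ
  have hmk := mul_meas_ge_le_integral_of_nonneg (μ := P)
    (Filter.Eventually.of_forall fun ω => by positivity) hint4 ((m * t) ^ 4)
  simp only [Finset.card_univ, Fintype.card_fin] at key
  have hsub : P.real {ω | t ≤ |(1 / (m : ℝ)) * ∑ i, Z i ω - μ|} ≤
      P.real {ω | (m * t) ^ 4 ≤ (∑ i, (Z i ω - μ)) ^ 4} := by
    refine measureReal_mono fun ω hω => ?_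
    simp only [Set.mem_ofPred_eq] at hω ⊢
    have : ∑ i, (Z i ω - μ) = m * ((1 / (m : ℝ)) * ∑ i, Z i ω - μ) := by
      rw [Finset.sum_sub_distrib]; simp; field_simp
    rw [this, mul_pow, mul_pow, ← (by decide : Even 4).pow_abs ((1 / (m : ℝ)) * ∑ i, Z i ω - μ)]
    gcongr
  refine hsub.trans ?_
  have h3 : (m * t) ^ 4 * P.real {ω | (m * t) ^ 4 ≤ (∑ i, (Z i ω - μ)) ^ 4} ≤
      3 * m ^ 2 * (4 * B ^ 2) ^ 2 := hmk.trans key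
  rw [div_pow, mul_div_assoc', div_div, le_div_iff₀ (by positivity)]
  have hm2 : (0 : ℝ) < m ^ 2 := by positivity
  have : m ^ 2 * (P.real {ω | (m * t) ^ 4 ≤ (∑ i, (Z i ω - μ)) ^ 4} * (t ^ 4 * m ^ 2)) ≤
      m ^ 2 * (48 * B ^ 4) := by nlinarith
  exact le_of_mul_le_mul_left this hm2

theorem measureReal_sum_gt_le {m : ℕ} (hm0 : 1 ≤ m) {Z : Fin m → Ω → ℝ}
    (hind : iIndepFun Z P) (hm : ∀ i, Measurable (Z i))
    (hZ : ∀ i, Integrable (fun ω => Z i ω ^ 4) P) {μ B : ℝ} (hμ : ∀ i, ∫ ω, Z i ω ∂P = μ)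
    (hB : 0 < B) (hZB : ∀ i, ∫ ω, Z i ω ^ 4 ∂P ≤ B ^ 4) :
    P.real {ω | 2 * B < (1 / (m : ℝ)) * ∑ i, Z i ω} ≤ 48 / m := by
  have h := measureReal_abs_sum_sub_ge_le hm0 hind hm hZ hμ hZB hB
  have hmpos : (1 : ℝ) ≤ m := by exact_mod_cast hm0
  refine (measureReal_mono ?_).trans (h.trans ?_)
  · intro ω hω
    simp only [Set.mem_ofPred_eq] at hω ⊢
    have h1 := abs_integral_le_of_pow_four (hm ⟨0, hm0⟩) (hZ _) hB.le (hZB _)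
    rw [hμ] at h1
    have := (abs_le.1 h1).2
    exact le_trans (by linarith) (le_abs_self _)
  · rw [div_self hB.ne']
    gcongr
    · norm_num
    · nlinarith

end

/-! ### Covering numbers of Lipschitz images of balls -/

/-- The volumetric bound on separated sets: the balls of radius `h / 2` are disjoint and lie in the
ball of radius `r + h / 2`. -/
theorem card_le_of_separated_closedBall {k : ℕ} {r h : ℝ} (hh : 0 < h) (hr : 0 ≤ r)
    (s : Finset (Vec k)) (hs : ∀ c ∈ s, ‖c‖ ≤ r)
    (hsep : ∀ c ∈ s, ∀ d ∈ s, c ≠ d → h ≤ ‖c - d‖) : (s.card : ℝ) ≤ (1 + 2 * r / h) ^ k := by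
  let μ : Measure (Vec k) := volume
  have D : Set.Pairwise (s : Set (Vec k))
      (Function.onFun Disjoint fun c => Metric.ball (c : Vec k) (h / 2)) := by
    rintro c hc d hd hcd
    apply Metric.ball_disjoint_ball
    rw [dist_eq_norm]
    linarith [hsep c hc d hd hcd]
  have hsub : (⋃ c ∈ s, Metric.ball (c : Vec k) (h / 2)) ⊆ Metric.ball (0 : Vec k) (r + h / 2) := by
    refine Set.iUnion₂_subset fun x hx => ?_
    apply Metric.ball_subset_ball'
    rw [dist_zero_right]
    linarith [hs x hx]
  have I : (s.card : ℝ≥0∞) * ENNReal.ofReal ((h / 2) ^ k) * μ (Metric.ball 0 1) ≤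
      ENNReal.ofReal ((r + h / 2) ^ k) * μ (Metric.ball 0 1) := by
    have h1 := measure_mono (μ := μ) hsub
    rw [measure_biUnion_finset D fun c _ => measurableSet_ball] at h1
    have h2 : 0 < h / 2 := by positivity
    have h3 : 0 < r + h / 2 := by positivity
    simp only [μ.addHaar_ball_of_pos _ h2, μ.addHaar_ball_of_pos _ h3, finrank_euclideanSpace,
      Fintype.card_fin, Finset.sum_const, nsmul_eq_mul, ← mul_assoc] at h1
    exact h1
  have J := (ENNReal.mul_le_mul_iff_left (Metric.measure_ball_pos _ _ zero_lt_one).ne'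
    measure_ball_lt_top.ne).1 I
  have K := ENNReal.toReal_le_of_le_ofReal (by positivity) J
  rw [ENNReal.toReal_mul, ENNReal.toReal_natCast, ENNReal.toReal_ofReal (by positivity),
    ← le_div_iff₀ (by positivity), ← div_pow] at K
  refine K.trans_eq ?_
  congr 1
  field_simp
  ring

theorem exists_finset_cover_closedBall {k : ℕ} {r h : ℝ} (hh : 0 < h) (hr : 0 ≤ r) :
    ∃ s : Finset (Vec k), (∀ c ∈ s, ‖c‖ ≤ r) ∧ (s.card : ℝ) ≤ (1 + 2 * r / h) ^ k ∧
      ∀ z : Vec k, ‖z‖ ≤ r → ∃ c ∈ s, ‖z - c‖ ≤ h := by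
  classical
  -- A separated set of maximal cardinality is a cover.
  let p : ℕ → Prop := fun N => ∃ s : Finset (Vec k), (∀ c ∈ s, ‖c‖ ≤ r) ∧
    (∀ c ∈ s, ∀ d ∈ s, c ≠ d → h ≤ ‖c - d‖) ∧ s.card = N
  have hb : ∀ N, p N → N ≤ ⌊(1 + 2 * r / h) ^ k⌋₊ := by
    rintro N ⟨s, h1, h2, rfl⟩
    exact Nat.le_floor (card_le_of_separated_closedBall hh hr s h1 h2)
  have h0 : p 0 := ⟨∅, by simp, by simp, rfl⟩
  obtain ⟨s, h1, h2, h3⟩ := Nat.findGreatest_spec (P := p) (hb 0 h0) h0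
  refine ⟨s, h1, card_le_of_separated_closedBall hh hr s h1 h2, fun z hz => ?_⟩
  by_contra! hcon
  have hzs : z ∉ s := fun hzs => by
    have := hcon z hzs
    simp at this
    linarith
  have hp : p (s.card + 1) := by
    refine ⟨insert z s, ?_, ?_, Finset.card_insert_of_notMem hzs⟩
    · simpa using ⟨hz, h1⟩
    · intro c hc d hd hcd
      rw [Finset.mem_insert] at hc hd
      rcases hc with rfl | hc <;> rcases hd with rfl | hd
      · exact absurd rfl hcd
      · exact (hcon d hd).le
      · rw [norm_sub_rev]; exact (hcon c hc).le
      · exact h2 c hc d hd hcd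
  have := Nat.le_findGreatest (hb _ hp) hp
  omega

/-- A finite net of the range of a generative model. -/
theorem exists_finset_net {k n : ℕ} {G : Vec k → Vec n} {L : ℝ≥0} {r : ℝ}
    (hG : IsGenModel G L r) (hL : 0 < L) {η : ℝ} (hη : 0 < η) :
    ∃ N : Finset (Vec n), (∀ q ∈ N, q ∈ genRange G r) ∧
      (N.card : ℝ) ≤ (1 + 2 * (L * r) / η) ^ k ∧
      ∀ u ∈ genRange G r, ∃ q ∈ N, ‖u - q‖ ≤ η := by
  classical
  have hL' : (0 : ℝ) < L := by exact_mod_cast hL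
  obtain ⟨s, h1, h2, h3⟩ := exists_finset_cover_closedBall (k := k) (h := η / L) (by positivity)
    hG.radius_pos.le
  refine ⟨s.image G, ?_, ?_, ?_⟩
  · intro q hq
    obtain ⟨c, hc, rfl⟩ := Finset.mem_image.1 hq
    exact ⟨c, by simpa using h1 c hc, rfl⟩
  · refine le_trans (by exact_mod_cast Finset.card_image_le) (h2.trans_eq ?_)
    congr 1
    field_simp
  · rintro _ ⟨z, hz, rfl⟩
    obtain ⟨c, hc, hzc⟩ := h3 z (by simpa using hz)
    refine ⟨G c, Finset.mem_image_of_mem _ hc, ?_⟩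
    have := hG.lipschitz.dist_le_mul z hz c (by simpa using h1 c hc)
    rw [dist_eq_norm, dist_eq_norm] at this
    refine this.trans ?_
    rw [le_div_iff₀ hL'] at hzc
    linarith

/-! ### Independence of the components of a Gaussian design -/

/-- The component of `b` orthogonal to the unit vector `x`. -/
noncomputable def orthPart {n : ℕ} (x b : Vec n) : Vec n := b - inner ℝ b x • x

theorem measurable_orthPart {n : ℕ} (x : Vec n) : Measurable (orthPart x) := by
  unfold orthPart; fun_prop

theorem inner_orthPart_left {n : ℕ} (x b q : Vec n) :
    inner ℝ (orthPart x b) q = inner ℝ b (orthPart x q) := by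
  simp only [orthPart, inner_sub_left, inner_sub_right, real_inner_smul_left, inner_smul_right]
  rw [real_inner_comm x q]; ring

theorem inner_eq_add_orthPart {n : ℕ} {x : Vec n} (b q : Vec n) :
    inner ℝ b q = inner ℝ b x * inner ℝ x q + inner ℝ b (orthPart x q) := by
  simp only [orthPart, inner_sub_right, inner_smul_right]
  rw [real_inner_comm x q]; ring

theorem norm_orthPart_le {n : ℕ} {x : Vec n} (hx : ‖x‖ = 1) (q : Vec n) :
    ‖orthPart x q‖ ≤ ‖q‖ := by
  have h : ‖orthPart x q‖ ^ 2 = ‖q‖ ^ 2 - inner ℝ q x ^ 2 := by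
    rw [orthPart, norm_sub_sq_real, norm_smul, inner_smul_right, hx]
    simp; ring
  have h2 : ‖orthPart x q‖ ^ 2 ≤ ‖q‖ ^ 2 := by linarith [sq_nonneg (inner ℝ q x : ℝ)]
  exact le_of_sq_le_sq h2 (norm_nonneg _)

section
variable {Ω : Type*} [MeasurableSpace Ω] {P : Measure Ω} [IsProbabilityMeasure P] {m n : ℕ}

theorem covariance_inner_stdGaussian (u v : Vec n) :
    cov[fun b => inner ℝ u b, fun b => inner ℝ v b; stdGaussian (Vec n)] = inner ℝ u v := by
  rw [← covarianceBilin_apply_eq_cov IsGaussian.memLp_two_id, covarianceBilin_stdGaussian]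
  rfl

theorem indepFun_inner_orthPart {x : Vec n} (hx : ‖x‖ = 1) :
    IndepFun (fun b => inner ℝ b x) (orthPart x) (stdGaussian (Vec n)) := by
  have hid : HasGaussianLaw (id : Vec n → Vec n) (stdGaussian (Vec n)) :=
    IsGaussian.hasGaussianLaw_id
  have h := hid.map_fun ((innerSL ℝ x).prod
    (ContinuousLinearMap.id ℝ (Vec n) - (innerSL ℝ x).smulRight x))
  have h' : HasGaussianLaw (fun b => (inner ℝ b x, orthPart x b)) (stdGaussian (Vec n)) := by
    refine h.congr (Filter.Eventually.of_forall fun b => ?_)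
    simp [orthPart, real_inner_comm]
  refine h'.indepFun_of_covariance_inner fun s q => ?_
  have e1 : (fun b : Vec n => inner ℝ s (inner ℝ b x : ℝ)) = fun b => inner ℝ (s • x) b := by
    ext b
    rw [real_inner_smul_left, real_inner_comm x b]
    simp [mul_comm]
  have e2 : (fun b : Vec n => inner ℝ q (orthPart x b)) = fun b => inner ℝ (orthPart x q) b := by
    ext b; rw [inner_orthPart_left]
  rw [e1, e2, covariance_inner_stdGaussian]
  simp only [orthPart, real_inner_smul_left, inner_sub_right, inner_smul_right,
    real_inner_self_eq_norm_sq, hx]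
  rw [real_inner_comm]; ring

theorem indepFun_prodMk_of_indepFun {α β γ : Type*} [MeasurableSpace α] [MeasurableSpace β]
    [MeasurableSpace γ] {U : Ω → α} {V : Ω → β} {Z : Ω → γ} (hU : Measurable U) (hV : Measurable V)
    (hZ : Measurable Z) (h1 : IndepFun U V P) (h2 : IndepFun (fun ω => (U ω, V ω)) Z P) :
    IndepFun (fun ω => (U ω, Z ω)) V P := by
  have e1 := (indepFun_iff_map_prod_eq_prod_map_map hU.aemeasurable hV.aemeasurable).1 h1
  have e2 := (indepFun_iff_map_prod_eq_prod_map_map (hU.prodMk hV).aemeasurable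
    hZ.aemeasurable).1 h2
  rw [e1] at e2
  have hUZ : IndepFun U Z P := h2.comp (φ := Prod.fst) (ψ := id) measurable_fst measurable_id
  have e3 := (indepFun_iff_map_prod_eq_prod_map_map hU.aemeasurable hZ.aemeasurable).1 hUZ
  rw [indepFun_iff_map_prod_eq_prod_map_map (hU.prodMk hZ).aemeasurable hV.aemeasurable, e3]
  have := Measure.isProbabilityMeasure_map (μ := P) hU.aemeasurable
  have := Measure.isProbabilityMeasure_map (μ := P) hV.aemeasurable
  have := Measure.isProbabilityMeasure_map (μ := P) hZ.aemeasurable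
  have f1 := measurePreserving_prodAssoc (P.map U) (P.map V) (P.map Z)
  have f2 := (MeasurePreserving.id (P.map U)).prod
    (Measure.measurePreserving_swap (μ := P.map V) (ν := P.map Z))
  have f3 := (measurePreserving_prodAssoc (P.map U) (P.map Z) (P.map V)).symm
  have f := (f3.comp (f2.comp f1)).map_eq
  rw [← e2, Measure.map_map (f3.comp (f2.comp f1)).measurable ((hU.prodMk hV).prodMk hZ)] at f
  exact f

theorem indepFun_pi_of_iIndepFun {α β : Type*} [MeasurableSpace α] [MeasurableSpace β]
    {X : Fin m → Ω → α} {Y : Fin m → Ω → β} (hX : ∀ i, Measurable (X i))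
    (hY : ∀ i, Measurable (Y i)) (h1 : iIndepFun (fun i ω => (X i ω, Y i ω)) P)
    (h2 : ∀ i, IndepFun (X i) (Y i) P) :
    IndepFun (fun ω i => X i ω) (fun ω i => Y i ω) P := by
  have hXi : iIndepFun X P := h1.comp (fun _ => Prod.fst) (fun _ => measurable_fst)
  have hYi : iIndepFun Y P := h1.comp (fun _ => Prod.snd) (fun _ => measurable_snd)
  have e1 := (iIndepFun_iff_map_fun_eq_pi_map fun i => (hX i).aemeasurable).1 hXi
  have e2 := (iIndepFun_iff_map_fun_eq_pi_map fun i => (hY i).aemeasurable).1 hYi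
  have e3 := (iIndepFun_iff_map_fun_eq_pi_map
    fun i => ((hX i).prodMk (hY i)).aemeasurable).1 h1
  have e4 : ∀ i, P.map (fun ω => (X i ω, Y i ω)) = (P.map (X i)).prod (P.map (Y i)) := fun i =>
    (indepFun_iff_map_prod_eq_prod_map_map (hX i).aemeasurable (hY i).aemeasurable).1 (h2 i)
  simp only [e4] at e3
  have := fun i => Measure.isProbabilityMeasure_map (μ := P) (hX i).aemeasurable
  have := fun i => Measure.isProbabilityMeasure_map (μ := P) (hY i).aemeasurable
  have hXm : Measurable fun ω i => X i ω := by fun_prop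
  have hYm : Measurable fun ω i => Y i ω := by fun_prop
  rw [indepFun_iff_map_prod_eq_prod_map_map hXm.aemeasurable hYm.aemeasurable, e1, e2]
  have f := measurePreserving_arrowProdEquivProdArrow α β (Fin m) (fun i => P.map (X i))
    (fun i => P.map (Y i))
  have f' := f.map_eq
  rw [← e3, Measure.map_map f.measurable (by fun_prop)] at f'
  exact f'

/-- To bound the probability of an event in two independent variables it suffices to do so for
each fixed value of the first one. -/
theorem measureReal_le_of_indepFun {α β : Type*} [MeasurableSpace α] [MeasurableSpace β]
    {U : Ω → α} {V : Ω → β} (hU : Measurable U) (hV : Measurable V) (h : IndepFun U V P)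
    {S : Set (α × β)} (hS : MeasurableSet S) {c : ℝ}
    (hc : ∀ w, P.real {ω | (w, V ω) ∈ S} ≤ c) : P.real {ω | (U ω, V ω) ∈ S} ≤ c := by
  have e := (indepFun_iff_map_prod_eq_prod_map_map hU.aemeasurable hV.aemeasurable).1 h
  have := Measure.isProbabilityMeasure_map (μ := P) hU.aemeasurable
  have := Measure.isProbabilityMeasure_map (μ := P) hV.aemeasurable
  have hc0 : 0 ≤ c := by
    have : Nonempty Ω := nonempty_of_isProbabilityMeasure P
    exact measureReal_nonneg.trans (hc (U (Classical.arbitrary Ω)))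
  have h1 : P {ω | (U ω, V ω) ∈ S} ≤ ENNReal.ofReal c := by
    have : P {ω | (U ω, V ω) ∈ S} = P.map (fun ω => (U ω, V ω)) S := by
      rw [Measure.map_apply (hU.prodMk hV) hS]; rfl
    rw [this, e, Measure.prod_apply hS]
    calc _ ≤ ∫⁻ _, ENNReal.ofReal c ∂(P.map U) := by
          refine lintegral_mono fun w => ?_
          rw [Measure.map_apply hV (measurable_prodMk_left hS)]
          rw [← ENNReal.ofReal_toReal (measure_ne_top P _)]
          exact ENNReal.ofReal_le_ofReal (hc w)
      _ = _ := by simp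
  exact ENNReal.toReal_le_of_le_ofReal hc0 h1

/-- The components along `x` together with the noise are independent of the orthogonal parts, as
uncorrelated jointly Gaussian variables are independent. -/
theorem IsDesign.indepFun_orthPart {Ξ : Type*} [MeasurableSpace Ξ] {a : Fin m → Ω → Vec n}
    {ξ : Fin m → Ω → Ξ} (hD : IsDesign P a ξ) {x : Vec n} (hx : ‖x‖ = 1) :
    IndepFun (fun ω i => ((inner ℝ (a i ω) x : ℝ), ξ i ω)) (fun ω i => orthPart x (a i ω)) P := by
  have hg : ∀ i, Measurable fun ω => (inner ℝ (a i ω) x : ℝ) := fun i => by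
    have := hD.measurable_vec i
    fun_prop
  have ho : ∀ i, Measurable fun ω => orthPart x (a i ω) := fun i =>
    (measurable_orthPart x).comp (hD.measurable_vec i)
  refine indepFun_pi_of_iIndepFun (X := fun i ω => ((inner ℝ (a i ω) x : ℝ), ξ i ω))
    (Y := fun i ω => orthPart x (a i ω)) (fun i => (hg i).prodMk (hD.measurable_noise i)) ho ?_
    fun i => ?_
  · exact hD.indep.comp (fun _ z => ((inner ℝ z.1 x, z.2), orthPart x z.1)) fun _ => by
      have := measurable_orthPart x
      fun_prop
  · refine indepFun_prodMk_of_indepFun (hg i) (ho i) (hD.measurable_noise i) ?_ ?_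
    · have h := indepFun_inner_orthPart hx
      rw [← hD.gaussian i] at h
      have hm := measurable_orthPart x
      have hb := hD.measurable_vec i
      have hg' : Measurable fun b : Vec n => (inner ℝ b x : ℝ) := by fun_prop
      rw [indepFun_iff_map_prod_eq_prod_map_map hg'.aemeasurable hm.aemeasurable,
        Measure.map_map (hg'.prodMk hm) hb, Measure.map_map hg' hb, Measure.map_map hm hb] at h
      exact (indepFun_iff_map_prod_eq_prod_map_map (hg i).aemeasurable (ho i).aemeasurable).2 h
    · exact (hD.noise_indep i).comp (φ := fun b => (inner ℝ b x, orthPart x b)) (ψ := id)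
        ((by fun_prop : Measurable fun b : Vec n => (inner ℝ b x : ℝ)).prodMk
          (measurable_orthPart x)) measurable_id

end

theorem IsDesign.iIndepFun_vec {Ω : Type*} [MeasurableSpace Ω] {P : Measure Ω} {m n : ℕ}
    {Ξ : Type*} [MeasurableSpace Ξ] {a : Fin m → Ω → Vec n} {ξ : Fin m → Ω → Ξ}
    (hD : IsDesign P a ξ) : iIndepFun a P :=
  hD.indep.comp (fun _ => Prod.fst) (fun _ => measurable_fst)

/-! ### Concentration on a finite set of directions -/

theorem measureReal_finset_biUnion_le {Ω ι : Type*} [MeasurableSpace Ω] {P : Measure Ω}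
    (s : Finset ι) (A : ι → Set Ω) {c : ℝ}
    (h : ∀ i ∈ s, P.real (A i) ≤ c) : P.real {ω | ∃ i ∈ s, ω ∈ A i} ≤ s.card * c := by
  have h1 := measureReal_biUnion_finset_le (μ := P) s A
  have : {ω | ∃ i ∈ s, ω ∈ A i} = ⋃ i ∈ s, A i := by ext; simp
  rw [this]
  exact h1.trans ((Finset.sum_le_sum h).trans_eq (by simp))

section
variable {Ω : Type*} [MeasurableSpace Ω] {P : Measure Ω} [IsProbabilityMeasure P] {m n : ℕ}
  {a : Fin m → Ω → Vec n}

theorem measureReal_abs_gt_le_of_linear (hind : iIndepFun a P) (hm : ∀ i, Measurable (a i))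
    (hg : ∀ i, P.map (a i) = stdGaussian (Vec n)) (b : Fin m → ℝ) {V D : ℝ} (hV : 0 < V)
    (hD : 0 ≤ D) (hb : ∑ i, b i ^ 2 ≤ V) (q : Vec n) :
    P.real {ω | √(2 * V * D) * ‖q‖ < |∑ i, b i * inner ℝ (a i ω) q|} ≤ 2 * Real.exp (-D) := by
  have h1 := measureReal_gt_le_of_linear hind hm hg b hV hD hb q
  have h2 := measureReal_gt_le_of_linear hind hm hg (fun i => -b i) hV hD (by simpa using hb) q
  refine (measureReal_le_add_of_subset_union h1 h2 fun ω hω => ?_).trans_eq (by ring)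
  simpa [lt_abs, Finset.sum_neg_distrib] using hω

theorem measureReal_isotropic_gt_le (hind : iIndepFun a P) (hm : ∀ i, Measurable (a i))
    (hg : ∀ i, P.map (a i) = stdGaussian (Vec n)) {V B D : ℝ} (hV : 0 < V) (hB : 0 < B)
    (hD : 0 ≤ D) (w : Fin m → ℝ) (hwV : ∑ i, w i ^ 2 ≤ V) (hwB : ∀ i, |w i| ≤ B)
    (F : Finset (Vec n)) :
    P.real {ω | ∃ p ∈ F ×ˢ F, (6 * √(V * D) + 24 * B * D) * (‖p.1‖ * ‖p.2‖) <
      |∑ i, w i * (inner ℝ (a i ω) p.1 * inner ℝ (a i ω) p.2 - inner ℝ p.1 p.2)|} ≤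
      (F.card : ℝ) ^ 2 * (4 * Real.exp (-D)) := by
  have h := measureReal_finset_biUnion_le (P := P) (F ×ˢ F)
    (fun p => {ω | (6 * √(V * D) + 24 * B * D) * (‖p.1‖ * ‖p.2‖) <
      |∑ i, w i * (inner ℝ (a i ω) p.1 * inner ℝ (a i ω) p.2 - inner ℝ p.1 p.2)|})
    (fun p _ => measureReal_gt_le_of_bilinear hind hm hg w hV hB hD hwV hwB p.1 p.2)
  rw [Finset.card_product] at h
  push_cast at h
  rw [← sq] at h
  exact h

/-- For weights which depend only on the components along `x` and on the noise, the weighted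
sample covariance differs from its part in the direction of `x` as if the weights were fixed. The set `S` carries the bounds on the weights. -/
theorem IsDesign.measureReal_weighted_gt_le {Ξ : Type*} [MeasurableSpace Ξ]
    {ξ : Fin m → Ω → Ξ} (hd : IsDesign P a ξ) {x : Vec n} (hx : ‖x‖ = 1)
    (w : (Fin m → ℝ × Ξ) → Fin m → ℝ) (hw : ∀ i, Measurable fun W => w W i)
    {S : Set (Fin m → ℝ × Ξ)} (hS : MeasurableSet S) {V V' B D : ℝ} (hV : 0 < V) (hV' : 0 < V')
    (hB : 0 < B) (hD : 0 ≤ D) (h0 : ∀ W, ∑ i, w W i = 0)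
    (hwV : ∀ W ∈ S, ∑ i, w W i ^ 2 ≤ V) (hwB : ∀ W ∈ S, ∀ i, |w W i| ≤ B)
    (hwV' : ∀ W ∈ S, ∑ i, (w W i * (W i).1) ^ 2 ≤ V') (F : Finset (Vec n)) :
    P.real {ω | (fun i => ((inner ℝ (a i ω) x : ℝ), ξ i ω)) ∈ S ∧ ∃ p ∈ F ×ˢ F,
      (2 * √(2 * V' * D) + (6 * √(V * D) + 24 * B * D)) * (‖p.1‖ * ‖p.2‖) <
      |∑ i, w (fun i => ((inner ℝ (a i ω) x : ℝ), ξ i ω)) i *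
          (inner ℝ (a i ω) p.1 * inner ℝ (a i ω) p.2) -
        inner ℝ x p.1 * inner ℝ x p.2 *
          ∑ i, w (fun i => ((inner ℝ (a i ω) x : ℝ), ξ i ω)) i * inner ℝ (a i ω) x ^ 2|} ≤
      (F.card : ℝ) ^ 2 * (8 * Real.exp (-D)) := by
  -- After the decomposition `aᵢ = ⟪aᵢ, x⟫ x + hᵢ` the part quadratic in `⟪aᵢ, x⟫` cancels, and `E`
  -- is what remains; it is controlled for each fixed value `W` of the weights.
  set T := 6 * √(V * D) + 24 * B * D with hT
  set T' := √(2 * V' * D) with hT'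
  let E : (Fin m → ℝ × Ξ) → (Fin m → Vec n) → Vec n × Vec n → ℝ := fun W H p =>
    inner ℝ x p.1 * ∑ i, (w W i * (W i).1) * inner ℝ (H i) p.2 +
    inner ℝ x p.2 * ∑ i, (w W i * (W i).1) * inner ℝ (H i) p.1 +
    ∑ i, w W i * (inner ℝ (H i) p.1 * inner ℝ (H i) p.2)
  let Q : Set ((Fin m → ℝ × Ξ) × (Fin m → Vec n)) :=
    {z | z.1 ∈ S ∧ ∃ p ∈ F ×ˢ F, (2 * T' + T) * (‖p.1‖ * ‖p.2‖) < |E z.1 z.2 p|}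
  have hQ : MeasurableSet Q := by
    have : Q = (Prod.fst ⁻¹' S) ∩
        ⋃ p ∈ F ×ˢ F, {z | (2 * T' + T) * (‖p.1‖ * ‖p.2‖) < |E z.1 z.2 p|} := by
      ext z; simp [Q]
    rw [this]
    refine (measurable_fst hS).inter (Finset.measurableSet_biUnion _ fun p _ => ?_)
    refine measurableSet_lt measurable_const ?_
    have hw' : ∀ i, Measurable fun z : (Fin m → ℝ × Ξ) × (Fin m → Vec n) => w z.1 i := fun i =>
      (hw i).comp measurable_fst
    have : Measurable fun z : (Fin m → ℝ × Ξ) × (Fin m → Vec n) => E z.1 z.2 p := by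
      simp only [E]
      fun_prop
    exact continuous_abs.measurable.comp this
  have hU : Measurable fun ω i => ((inner ℝ (a i ω) x : ℝ), ξ i ω) := by
    have h1 := hd.measurable_vec
    have h2 := hd.measurable_noise
    fun_prop
  have hV2 : Measurable fun ω i => orthPart x (a i ω) :=
    measurable_pi_lambda _ fun i => (measurable_orthPart x).comp (hd.measurable_vec i)
  have key := measureReal_le_of_indepFun hU hV2 (hd.indepFun_orthPart hx) hQ
    (c := (F.card : ℝ) ^ 2 * (8 * Real.exp (-D))) ?_
  · refine le_trans (measureReal_mono ?_) key
    rintro ω ⟨h1, p, hp, h2⟩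
    refine ⟨h1, p, hp, lt_of_lt_of_eq h2 (congrArg abs ?_)⟩
    simp only [E, Finset.mul_sum, ← Finset.sum_add_distrib, ← Finset.sum_sub_distrib]
    refine Finset.sum_congr rfl fun i _ => ?_
    rw [inner_eq_add_orthPart (x := x) (a i ω) p.1, inner_eq_add_orthPart (x := x) (a i ω) p.2,
      inner_orthPart_left, inner_orthPart_left]
    ring
  · intro W
    by_cases hW : W ∈ S
    swap
    · have : {ω | (W, fun i => orthPart x (a i ω)) ∈ Q} = ∅ := by
        ext ω; simp [Q, hW]
      rw [this]
      simp only [measureReal_empty]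
      positivity
    have hsub : {ω | (W, fun i => orthPart x (a i ω)) ∈ Q} ⊆ {ω | ∃ p ∈ F ×ˢ F,
        ω ∈ {ω | (2 * T' + T) * (‖p.1‖ * ‖p.2‖) < |E W (fun i => orthPart x (a i ω)) p|}} :=
      fun ω hω => hω.2
    refine (measureReal_mono hsub).trans ?_
    refine (measureReal_finset_biUnion_le _ _ (c := 8 * Real.exp (-D)) fun p _ => ?_).trans_eq ?_
    · have l1 := measureReal_abs_gt_le_of_linear hd.iIndepFun_vec hd.measurable_vec hd.gaussian
        _ hV' hD (hwV' W hW) (orthPart x p.1)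
      have l2 := measureReal_abs_gt_le_of_linear hd.iIndepFun_vec hd.measurable_vec hd.gaussian
        _ hV' hD (hwV' W hW) (orthPart x p.2)
      have l3 := measureReal_gt_le_of_bilinear hd.iIndepFun_vec hd.measurable_vec hd.gaussian
        _ hV hB hD (hwV W hW) (hwB W hW) (orthPart x p.1) (orthPart x p.2)
      refine (measureReal_le_add_of_subset_union l1 (measureReal_le_add_of_subset_union l2 l3
        subset_rfl) fun ω hω => ?_).trans_eq (by ring)
      by_contra hcon
      simp only [Set.mem_union, Set.mem_ofPred_eq, not_or, not_lt] at hcon hω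
      obtain ⟨c1, c2, c3⟩ := hcon
      have n1 := norm_orthPart_le hx p.1
      have n2 := norm_orthPart_le hx p.2
      have i1 : |inner ℝ x p.1| ≤ ‖p.1‖ := by
        simpa [hx] using abs_real_inner_le_norm x p.1
      have i2 : |inner ℝ x p.2| ≤ ‖p.2‖ := by
        simpa [hx] using abs_real_inner_le_norm x p.2
      have hTT : 0 ≤ T := by positivity
      have hTT' : 0 ≤ T' := by positivity
      simp only [mul_sub, Finset.sum_sub_distrib, ← Finset.sum_mul, h0, zero_mul, sub_zero] at c3
      have b1 : |inner ℝ x p.1 * ∑ i, (w W i * (W i).1) * inner ℝ (orthPart x (a i ω)) p.2| ≤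
          ‖p.1‖ * (T' * ‖p.2‖) := by
        rw [abs_mul]
        simp only [inner_orthPart_left]
        gcongr
        exact c2.trans (by gcongr)
      have b2 : |inner ℝ x p.2 * ∑ i, (w W i * (W i).1) * inner ℝ (orthPart x (a i ω)) p.1| ≤
          ‖p.2‖ * (T' * ‖p.1‖) := by
        rw [abs_mul]
        simp only [inner_orthPart_left]
        gcongr
        exact c1.trans (by gcongr)
      have b3 : |∑ i, w W i * (inner ℝ (orthPart x (a i ω)) p.1 *
          inner ℝ (orthPart x (a i ω)) p.2)| ≤ T * (‖p.1‖ * ‖p.2‖) := by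
        simp only [inner_orthPart_left]
        exact c3.trans (by gcongr)
      have b4 := abs_add_three
        (inner ℝ x p.1 * ∑ i, (w W i * (W i).1) * inner ℝ (orthPart x (a i ω)) p.2)
        (inner ℝ x p.2 * ∑ i, (w W i * (W i).1) * inner ℝ (orthPart x (a i ω)) p.1)
        (∑ i, w W i * (inner ℝ (orthPart x (a i ω)) p.1 * inner ℝ (orthPart x (a i ω)) p.2))
      simp only [E] at hω
      nlinarith
    · rw [Finset.card_product]; push_cast; ring

end

/-! ### One projected gradient step -/

/-- The empirical bilinear form `(1/m) ∑ i, w i (a iᵀ u) (a iᵀ v)` with weights `w`. -/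
noncomputable def empForm {m n : ℕ} (a : Fin m → Vec n) (w : Fin m → ℝ) (u v : Vec n) : ℝ :=
  (1 / (m : ℝ)) * ∑ i, w i * (inner ℝ (a i) u * inner ℝ (a i) v)

/-- The gradient step in terms of the empirical forms; the estimate `ν̂` is itself the value of such
a form at `u`. -/
theorem inner_gradStep {m n : ℕ} (ζ : ℝ) (a : Fin m → Vec n) (y : Fin m → ℝ) (u v : Vec n) :
    inner ℝ (gradStep ζ a y u) v = inner ℝ u v -
      ζ * (empForm a (fun i => y i - empMean y) u u * empForm a 1 u v -
        empForm a (fun i => y i - empMean y) u v) := by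
  have h : scaleEst a y u = empForm a (fun i => y i - empMean y) u u := by
    simp only [scaleEst, empForm, sq]
  rw [gradStep, h, inner_sub_left, real_inner_smul_left, sum_inner]
  congr 1
  simp only [real_inner_smul_left, centeredResponse]
  rw [div_mul_eq_mul_div, mul_div_assoc]
  congr 1
  rw [empForm, empForm, empForm, Finset.mul_sum, Finset.mul_sum, Finset.mul_sum, Finset.mul_sum,
    ← Finset.sum_sub_distrib, Finset.sum_div]
  refine Finset.sum_congr rfl fun i _ => ?_
  simp only [Pi.one_apply]
  ring

/-- The basic inequality for the projection, from `‖p - s‖ ≤ ‖x - s‖`. -/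
theorem sq_norm_sub_le_of_isProjection {k n : ℕ} {G : Vec k → Vec n} {r : ℝ} {s p x : Vec n}
    (hp : IsProjection G r s p) (hx : x ∈ genRange G r) :
    ‖p - x‖ ^ 2 ≤ 2 * inner ℝ (s - x) (p - x) := by
  obtain ⟨z, hz, hmin, rfl⟩ := hp
  obtain ⟨z', hz', rfl⟩ := hx
  have h := hmin z' hz'
  have h1 : ‖G z - s‖ ^ 2 ≤ ‖G z' - s‖ ^ 2 := by gcongr
  have e : G z - s = (G z - G z') - (s - G z') := by abel
  have e' : G z' - s = -(s - G z') := by abel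
  rw [e, e', norm_neg, norm_sub_sq_real, real_inner_comm] at h1
  linarith

theorem inner_sub_eq_of_norm_eq_one {n : ℕ} {x p : Vec n} (hx : ‖x‖ = 1) (hp : ‖p‖ = 1) :
    inner ℝ x (p - x) = -(‖p - x‖ ^ 2 / 2) := by
  have h := norm_sub_sq_real p x
  rw [hx, hp] at h
  rw [inner_sub_right, real_inner_self_eq_norm_sq, hx, real_inner_comm]
  linarith

theorem norm_sub_le_two {n : ℕ} {x p : Vec n} (hx : ‖x‖ = 1) (hp : ‖p‖ = 1) : ‖p - x‖ ≤ 2 := by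
  linarith [norm_sub_le p x]

/-- The effect of the deviations of the empirical forms. Here `Q`, `R` and `S` stand for the forms at
`(u, u)`, at `(u, v)` and at `(u, v)` with weights `1`, and `V = ‖v‖`, `δ = ‖u - x‖`,
`I = ⟪u - x, v⟫`, `c = ⟪x, u⟫`, while `-(V ^ 2 / 2) = ⟪x, v⟫`. -/
theorem noise_le_aux {ν τ b b' Q R S I V δ c : ℝ} (hν : 0 < ν) (hτ : 0 ≤ τ) (hb : 0 ≤ b)
    (hc : c ^ 2 ≤ 1) (hδ : δ ≤ 2) (hV0 : 0 ≤ V) (hV : V ≤ 2) (hI : |I| ≤ δ * V)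
    (h1 : |R - ν * (c * -(V ^ 2 / 2))| ≤ b * V + τ * (V ^ 2 / 2))
    (h2 : |Q - ν * c ^ 2| ≤ b + τ) (h3 : |S - (I + -(V ^ 2 / 2))| ≤ b' * V) :
    |Q * S - R - (ν * c ^ 2 * (I + -(V ^ 2 / 2)) - ν * (c * -(V ^ 2 / 2)))| ≤
      ((ν + b + τ) * b' + 4 * b) * V + τ * δ * V + τ * V ^ 2 := by
  have hQ : |Q| ≤ ν + b + τ := by
    have h4 : |ν * c ^ 2| ≤ ν := by
      rw [abs_of_nonneg (by positivity)]
      exact mul_le_of_le_one_right hν.le hc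
    have := abs_sub_abs_le_abs_sub Q (ν * c ^ 2)
    linarith
  have e : Q * S - R - (ν * c ^ 2 * (I + -(V ^ 2 / 2)) - ν * (c * -(V ^ 2 / 2))) =
      Q * (S - (I + -(V ^ 2 / 2))) + (Q - ν * c ^ 2) * (I + -(V ^ 2 / 2)) +
        -(R - ν * (c * -(V ^ 2 / 2))) := by ring
  have t1 : |Q * (S - (I + -(V ^ 2 / 2)))| ≤ (ν + b + τ) * (b' * V) := by
    rw [abs_mul]; exact mul_le_mul hQ h3 (abs_nonneg _) (by positivity)
  have t2 : |(Q - ν * c ^ 2) * (I + -(V ^ 2 / 2))| ≤ (b + τ) * (δ * V + V ^ 2 / 2) := by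
    rw [abs_mul]
    refine mul_le_mul h2 ?_ (abs_nonneg _) (by positivity)
    refine (abs_add_le _ _).trans ?_
    rw [abs_neg, abs_of_nonneg (a := V ^ 2 / 2) (by positivity)]
    linarith
  have t3 : b * (δ * V + V ^ 2 / 2) ≤ b * (3 * V) := by
    have w1 : δ * V ≤ 2 * V := by gcongr
    have w2 : V * V ≤ 2 * V := by gcongr
    gcongr
    linarith
  rw [e]
  refine (abs_add_three _ _ _).trans ?_
  rw [abs_neg]
  linarith

/-- The step with the expectations in place of the empirical forms, in the notation of
`noise_le_aux` and with `s = ζ ν`. -/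
theorem population_step_le_aux {s I V δ c : ℝ} (hs : 0 < s) (hδ0 : 0 ≤ δ) (hδ : δ ≤ 2)
    (hV0 : 0 ≤ V) (hV : V ≤ 2) (hI : |I| ≤ δ * V) (hc : c = 1 - δ ^ 2 / 2) (hcm : -1 ≤ c) :
    (1 - s * c ^ 2) * I - s * c * (1 - c) * (V ^ 2 / 2) ≤
      ((|1 - s| + 2 * s * δ) * δ + s * δ ^ 2 / 2) * V := by
  have hc0 : 0 ≤ 1 - c := by rw [hc]; nlinarith
  have s1 : |1 - s * c ^ 2| ≤ |1 - s| + 2 * s * δ := by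
    have e : 1 - s * c ^ 2 = (1 - s) + s * (1 - c ^ 2) := by ring
    rw [e]
    refine (abs_add_le _ _).trans ?_
    have hcsq : 0 ≤ 1 - c ^ 2 := by nlinarith
    rw [abs_of_nonneg (a := s * (1 - c ^ 2)) (by positivity)]
    have w : 1 - c ^ 2 ≤ 2 * δ := by
      have w1 : 1 - c ^ 2 ≤ 2 * (1 - c) := by nlinarith
      have w2 : δ * δ ≤ 2 * δ := by gcongr
      linarith
    have := mul_le_mul_of_nonneg_left w hs.le
    linarith
  have s2 : (1 - s * c ^ 2) * I ≤ (|1 - s| + 2 * s * δ) * (δ * V) := by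
    refine (le_abs_self _).trans ?_
    rw [abs_mul]
    exact mul_le_mul s1 hI (abs_nonneg _) (by positivity)
  have s3 : -(c * (1 - c)) * (V ^ 2 / 2) ≤ δ ^ 2 / 2 * V := by
    have w1 : -(c * (1 - c)) ≤ δ ^ 2 / 2 := by nlinarith
    have w2 : V ^ 2 / 2 ≤ V := by nlinarith
    calc _ ≤ δ ^ 2 / 2 * (V ^ 2 / 2) := by gcongr
      _ ≤ _ := by gcongr
  have s4 := mul_le_mul_of_nonneg_left s3 hs.le
  linarith

/-- The effect of one projected gradient step on the error. The estimates `h1`, `h2` and `h3`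
compare the empirical forms with their expectations. The first two have, in the direction of `x`,
an error `τ` which need not be small compared with the statistical error: it only enters
multiplied by an error norm, since `⟪x, p - x⟫ = -‖p - x‖² / 2` on the sphere. -/
theorem norm_step_le {k m n : ℕ} {G : Vec k → Vec n} {r ζ ν τ b b' : ℝ} {a : Fin m → Vec n}
    {y : Fin m → ℝ} {x u p : Vec n} (hx : x ∈ genRange G r) (hx1 : ‖x‖ = 1) (hu1 : ‖u‖ = 1)
    (hp1 : ‖p‖ = 1) (hζ : 0 < ζ) (hν : 0 < ν) (hτ : 0 ≤ τ) (hb : 0 ≤ b)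
    (hp : IsProjection G r (gradStep ζ a y u) p) (hV : 0 < ‖p - x‖)
    (h1 : |empForm a (fun i => y i - empMean y) u (p - x) - ν * (inner ℝ x u * inner ℝ x (p - x))| ≤
      b * ‖p - x‖ + τ * |inner ℝ x (p - x)|)
    (h2 : |empForm a (fun i => y i - empMean y) u u - ν * inner ℝ x u ^ 2| ≤ b + τ)
    (h3 : |empForm a 1 u (p - x) - inner ℝ u (p - x)| ≤ b' * ‖p - x‖) :
    ‖p - x‖ ≤ (2 * |1 - ζ * ν| + 5 * ζ * ν * ‖u - x‖ + 2 * ζ * τ) * ‖u - x‖ +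
      2 * ζ * τ * ‖p - x‖ + 2 * ζ * ((ν + b + τ) * b' + 4 * b) := by
  have key := sq_norm_sub_le_of_isProjection hp hx
  rw [inner_sub_left, inner_gradStep] at key
  have hxv := inner_sub_eq_of_norm_eq_one hx1 hp1
  have hxu := inner_sub_eq_of_norm_eq_one hx1 hu1
  have hc : inner ℝ x u = 1 - ‖u - x‖ ^ 2 / 2 := by
    rw [inner_sub_right, real_inner_self_eq_norm_sq, hx1] at hxu; linarith
  have huv : inner ℝ u (p - x) = inner ℝ (u - x) (p - x) + inner ℝ x (p - x) := by
    rw [← inner_add_left]; congr 1; abel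
  have hab := abs_real_inner_le_norm (u - x) (p - x)
  have hd2 := norm_sub_le_two hx1 hu1
  have hV2 := norm_sub_le_two hx1 hp1
  have hd0 : 0 ≤ ‖u - x‖ := norm_nonneg _
  have hcc : |inner ℝ x u| ≤ 1 := by
    simpa [hx1, hu1] using abs_real_inner_le_norm x u
  rw [huv] at key h3
  set Q := empForm a (fun i => y i - empMean y) u u
  set R := empForm a (fun i => y i - empMean y) u (p - x)
  set S := empForm a 1 u (p - x)
  set V := ‖p - x‖
  set δ := ‖u - x‖
  set I := (inner ℝ (u - x) (p - x) : ℝ)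
  rw [hxv] at key h1 h3
  set c := (inner ℝ x u : ℝ)
  have hvabs : |(-(V ^ 2 / 2))| = V ^ 2 / 2 := by
    rw [abs_neg, abs_of_nonneg (by positivity)]
  rw [hvabs] at h1
  have hcsq : c ^ 2 ≤ 1 := by rw [← sq_abs]; exact pow_le_one₀ (abs_nonneg _) hcc
  have hN := noise_le_aux hν hτ hb hcsq hd2 hV.le hV2 hab h1 h2 h3
  have hpop := population_step_le_aux (mul_pos hζ hν) hd0 hd2 hV.le hV2 hab hc (abs_le.1 hcc).1
  have hNl := mul_le_mul_of_nonneg_left ((neg_le_abs _).trans hN) (by positivity : 0 ≤ 2 * ζ)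
  refine le_of_mul_le_mul_right ?_ hV
  linarith

/-! ### Iteration of the contraction -/

/-- Iteration of a contraction which is only available while the error is not too large: the error
never exceeds the larger of its initial value and `E`, so the contraction remains available. -/
theorem exists_stopping_time {d : ℕ → ℝ} {ρ θ β₁ β₂ ε E : ℝ} (hd : ∀ t, 0 ≤ d t)
    (hd2 : d 0 ≤ 2) (hρ : 0 ≤ ρ) (hθ : 0 ≤ θ) (hβ₁ : 0 < β₁) (hβ₂ : 0 < β₂) (hE : 0 < E)
    (hε : 2 * ε ≤ β₂ * E) (hε0 : 0 ≤ ε) (hθE : θ * E ≤ β₁ / 2)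
    (h0 : ρ + θ * d 0 + β₁ ≤ 1 - β₂)
    (hstep : ∀ t, ρ + θ * d t + β₁ / 2 ≤ 1 - β₂ → d (t + 1) ≤ (1 - β₂) * d t + ε)
    {N : ℕ} (hN : (1 - β₂) ^ N * 2 ≤ E / 2) :
    ∃ T₀ ≤ N, StrictAntiOn d (Set.Icc 0 T₀) ∧ (∀ t, d t < (1 - β₂) ^ t * d 0 + E) ∧
      ∀ t ≥ T₀, d t ≤ E := by
  have hb : 0 ≤ 1 - β₂ := by
    have := mul_nonneg hθ (hd 0)
    linarith
  have hmax : ∀ t, d t ≤ max (d 0) E ∧ d (t + 1) ≤ (1 - β₂) * d t + ε := by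
    have hstep' : ∀ t, d t ≤ max (d 0) E → d (t + 1) ≤ (1 - β₂) * d t + ε := by
      intro t ht
      apply hstep t
      rcases le_max_iff.1 ht with h | h
      · have := mul_le_mul_of_nonneg_left h hθ
        linarith
      · have := mul_le_mul_of_nonneg_left h hθ
        have := mul_nonneg hθ (hd 0)
        linarith
    intro t
    induction t with
    | zero => exact ⟨le_max_left _ _, hstep' 0 (le_max_left _ _)⟩
    | succ t ih =>
      have h1 : d (t + 1) ≤ max (d 0) E := by
        have h2 := mul_le_mul_of_nonneg_left ih.1 hb
        have h3 := mul_le_mul_of_nonneg_left (le_max_right (d 0) E) hβ₂.le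
        linarith [ih.2]
      exact ⟨h1, hstep' _ h1⟩
  have hrec := fun t => (hmax t).2
  have hgeo : ∀ t, d t ≤ (1 - β₂) ^ t * d 0 + E / 2 := by
    intro t
    induction t with
    | zero => simp; linarith
    | succ t ih =>
      have h2 := mul_le_mul_of_nonneg_left ih hb
      rw [pow_succ']
      linarith [hrec t]
  classical
  have hex : ∃ t, d t ≤ E := by
    refine ⟨N, (hgeo N).trans ?_⟩
    have := mul_le_mul_of_nonneg_left hd2 (pow_nonneg hb N)
    linarith
  have hNE : d N ≤ E := by
    have := mul_le_mul_of_nonneg_left hd2 (pow_nonneg hb N)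
    linarith [hgeo N]
  refine ⟨Nat.find hex, Nat.find_min' hex hNE, ?_, ?_, ?_⟩
  · have hlt : ∀ t < Nat.find hex, d (t + 1) < d t := by
      intro t ht
      have h1 := Nat.find_min hex ht
      push Not at h1
      have h2 := mul_lt_mul_of_pos_left h1 hβ₂
      linarith [hrec t]
    intro s _ t ht hst
    have ht' : t ≤ Nat.find hex := ht.2
    clear ht
    induction t, hst using Nat.le_induction with
    | base => exact hlt s ht'
    | succ t hst ih => exact (hlt t ht').trans (ih (by omega))
  · intro t
    linarith [hgeo t]
  · intro t ht
    induction t, ht using Nat.le_induction with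
    | base => exact Nat.find_spec hex
    | succ t _ ih =>
      have := mul_le_mul_of_nonneg_left ih hb
      linarith [hrec t]

/-! ### Moments and tails of the data -/

section
variable {Ω : Type*} [MeasurableSpace Ω] {P : Measure Ω}

theorem lintegral_rpow_le_of_psiOneNorm {X : Ω → ℝ} {K : ℝ} (hK : 0 ≤ K)
    (h : psiOneNorm X P ≤ ENNReal.ofReal K) {p : ℝ} (hp : 1 ≤ p) :
    ∫⁻ ω, ‖X ω‖ₑ ^ p ∂P ≤ ENNReal.ofReal ((p * K) ^ p) := by
  have hp0 : 0 < p := by linarith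
  have h1 : (∫⁻ ω, ‖X ω‖ₑ ^ p ∂P) ^ (1 / p) / ENNReal.ofReal p ≤ ENNReal.ofReal K :=
    (le_iSup₂ (f := fun (p : ℝ) (_ : 1 ≤ p) =>
      (∫⁻ ω, ‖X ω‖ₑ ^ p ∂P) ^ (1 / p) / ENNReal.ofReal p) p hp).trans h
  rw [ENNReal.div_le_iff (by simpa using hp0) ENNReal.ofReal_ne_top,
    ← ENNReal.ofReal_mul hK, one_div, ENNReal.rpow_inv_le_iff hp0,
    ENNReal.ofReal_rpow_of_nonneg (by positivity) hp0.le, mul_comm] at h1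
  exact h1

theorem integrable_pow_and_integral_le_of_psiOneNorm {X : Ω → ℝ} (hX : Measurable X) {K : ℝ}
    (hK : 0 ≤ K) (h : psiOneNorm X P ≤ ENNReal.ofReal K) {N : ℕ} (hN : Even N) (hN1 : 1 ≤ N) :
    Integrable (fun ω => X ω ^ N) P ∧ ∫ ω, X ω ^ N ∂P ≤ (N * K) ^ N := by
  have h1 := lintegral_rpow_le_of_psiOneNorm hK h (p := N) (by exact_mod_cast hN1)
  have e : ∀ ω, ‖X ω‖ₑ ^ (N : ℝ) = ENNReal.ofReal (X ω ^ N) := fun ω => by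
    rw [ENNReal.rpow_natCast, Real.enorm_eq_ofReal_abs, ← ENNReal.ofReal_pow (abs_nonneg _),
      hN.pow_abs]
  simp only [e, Real.rpow_natCast] at h1
  have hnn : ∀ ω, 0 ≤ X ω ^ N := fun ω => hN.pow_nonneg _
  constructor
  · refine ⟨by fun_prop, ?_⟩
    rw [hasFiniteIntegral_iff_ofReal (Filter.Eventually.of_forall hnn)]
    exact h1.trans_lt ENNReal.ofReal_lt_top
  · rw [integral_eq_lintegral_of_nonneg_ae (Filter.Eventually.of_forall hnn) (by fun_prop)]
    exact ENNReal.toReal_le_of_le_ofReal (by positivity) h1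

/-- The sub-exponential tail, by Markov's inequality for the moment of order `p`. -/
theorem measureReal_abs_gt_le_of_psiOneNorm {X : Ω → ℝ} (hX : Measurable X) {K : ℝ}
    (hK : 0 < K) (h : psiOneNorm X P ≤ ENNReal.ofReal K) {p : ℝ} (hp : 1 ≤ p) :
    P.real {ω | 3 * p * K < |X ω|} ≤ Real.exp (-p) := by
  have hp0 : 0 < p := by linarith
  have h1 := lintegral_rpow_le_of_psiOneNorm hK.le h hp
  have h3 : {ω | 3 * p * K < |X ω|} ⊆
      {ω | ENNReal.ofReal ((Real.exp 1 * (p * K)) ^ p) ≤ ‖X ω‖ₑ ^ p} := by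
    intro ω hω
    simp only [Set.mem_ofPred_eq] at hω ⊢
    rw [Real.enorm_eq_ofReal_abs, ENNReal.ofReal_rpow_of_nonneg (abs_nonneg _) hp0.le]
    apply ENNReal.ofReal_le_ofReal
    apply Real.rpow_le_rpow (by positivity) _ hp0.le
    have he := Real.exp_one_lt_d9
    have : Real.exp 1 * (p * K) ≤ 3 * (p * K) := by gcongr; linarith
    linarith
  have h2 : ENNReal.ofReal ((Real.exp 1 * (p * K)) ^ p) * P {ω | 3 * p * K < |X ω|} ≤
      ENNReal.ofReal ((p * K) ^ p) :=
    le_trans (by gcongr) ((mul_meas_ge_le_lintegral₀ (by fun_prop) _).trans h1)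
  have h4 := ENNReal.toReal_le_of_le_ofReal (by positivity) h2
  rw [ENNReal.toReal_mul, ENNReal.toReal_ofReal (by positivity),
    Real.mul_rpow (by positivity) (by positivity), Real.exp_one_rpow] at h4
  have hpos : 0 < (p * K) ^ p := by positivity
  rw [Real.exp_neg, ← one_div, le_div_iff₀ (Real.exp_pos _)]
  refine le_of_mul_le_mul_right ?_ hpos
  calc _ = Real.exp p * (p * K) ^ p * (P {ω | 3 * p * K < |X ω|}).toReal := by
        rw [Measure.real]; ring
    _ ≤ _ := by rw [one_mul]; exact h4

/-- An absolute constant which dominates the moments of a standard Gaussian variable up to the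
sixteenth. -/
noncomputable def gaussMoment : ℝ := 1 + ∫ t, t ^ 16 ∂(gaussianReal 0 1)

theorem one_le_gaussMoment : 1 ≤ gaussMoment := by
  have : 0 ≤ ∫ t, t ^ 16 ∂(gaussianReal 0 1) := integral_nonneg fun t => by positivity
  rw [gaussMoment]; linarith

theorem integrable_pow_gaussianReal (N : ℕ) (hN : Even N) :
    Integrable (fun t => t ^ N) (gaussianReal 0 1) := by
  have h := (memLp_id_gaussianReal (μ := 0) (v := 1) N).integrable_norm_pow'
  refine h.congr (Filter.Eventually.of_forall fun t => ?_)
  simp [hN.pow_abs]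

section
variable {n : ℕ} {b : Ω → Vec n}

theorem integrable_inner_pow (hm : Measurable b) (hb : P.map b = stdGaussian (Vec n)) {x : Vec n}
    (hx : ‖x‖ = 1) {N : ℕ} (hN : Even N) : Integrable (fun ω => (inner ℝ (b ω) x : ℝ) ^ N) P := by
  have h := integrable_pow_gaussianReal N hN
  have e := map_inner_eq_map_mul hm hb x
  simp only [hx, one_mul, Measure.map_id'] at e
  rw [← e] at h
  exact h.comp_measurable (by fun_prop)

theorem integral_inner_pow (hm : Measurable b) (hb : P.map b = stdGaussian (Vec n)) {x : Vec n}
    (hx : ‖x‖ = 1) (N : ℕ) :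
    ∫ ω, (inner ℝ (b ω) x : ℝ) ^ N ∂P = ∫ t, t ^ N ∂(gaussianReal 0 1) := by
  have e := map_inner_eq_map_mul hm hb x
  simp only [hx, one_mul, Measure.map_id'] at e
  rw [← e, integral_map (by fun_prop) (by fun_prop)]

theorem integral_pow_eight_le : ∫ t, t ^ 8 ∂(gaussianReal 0 1) ≤ gaussMoment := by
  have h : ∀ t : ℝ, t ^ 8 ≤ 1 + t ^ 16 := fun t => by nlinarith [sq_nonneg (t ^ 8 - 1)]
  refine (integral_mono (integrable_pow_gaussianReal 8 (by decide))
    ((integrable_const 1).add (integrable_pow_gaussianReal 16 (by decide))) h).trans_eq ?_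
  simp only [Pi.add_apply]
  rw [integral_add (integrable_const _) (integrable_pow_gaussianReal 16 (by decide))]
  simp [gaussMoment]

theorem integral_sq_gaussianReal : ∫ t, t ^ 2 ∂(gaussianReal 0 1) = 1 := by
  have h := variance_eq_sub (memLp_id_gaussianReal (μ := 0) (v := 1) 2)
  rw [variance_id_gaussianReal] at h
  simpa using h.symm

theorem integrable_and_integral_le_of_le_half_add {A B C : Ω → ℝ} (hA : Integrable A P)
    (hB : Integrable B P) (hC : Measurable C) (h0 : ∀ ω, 0 ≤ C ω)
    (h : ∀ ω, C ω ≤ (A ω + B ω) / 2) {α β : ℝ} (hα : ∫ ω, A ω ∂P ≤ α) (hβ : ∫ ω, B ω ∂P ≤ β) :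
    Integrable C P ∧ ∫ ω, C ω ∂P ≤ (α + β) / 2 := by
  have hAB : Integrable (fun ω => (A ω + B ω) / 2) P := (hA.add hB).div_const 2
  have hCi : Integrable C P := hAB.mono' hC.aestronglyMeasurable
    (Filter.Eventually.of_forall fun ω => by
      rw [Real.norm_eq_abs, abs_of_nonneg (h0 ω)]; exact h ω)
  refine ⟨hCi, (integral_mono hCi hAB h).trans ?_⟩
  rw [integral_div, integral_add hA hB]
  linarith

theorem mul_le_half_add_of_pos {A B c : ℝ} (hc : 0 < c) :
    A * B ≤ (A ^ 2 / c + c * B ^ 2) / 2 := by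
  have h : A ^ 2 / c + c * B ^ 2 - 2 * (A * B) = (A - c * B) ^ 2 / c := by field_simp; ring
  have : 0 ≤ (A - c * B) ^ 2 / c := by positivity
  linarith

variable {Y : Ω → ℝ} {K : ℝ} {x : Vec n}

theorem moment_mul_sq_inner (hm : Measurable b) (hb : P.map b = stdGaussian (Vec n))
    (hx : ‖x‖ = 1) (hY : Measurable Y) (hK : 0 < K) (hYK : psiOneNorm Y P ≤ ENNReal.ofReal K) :
    Integrable (fun ω => (Y ω * inner ℝ (b ω) x ^ 2) ^ 4) P ∧
      ∫ ω, (Y ω * inner ℝ (b ω) x ^ 2) ^ 4 ∂P ≤ (64 * gaussMoment * K) ^ 4 := by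
  have hM := one_le_gaussMoment
  obtain ⟨i1, i2⟩ := integrable_pow_and_integral_le_of_psiOneNorm hY hK.le hYK (N := 8)
    (by decide) (by norm_num)
  have j1 := integrable_inner_pow hm hb hx (N := 16) (by decide)
  have j2 := integral_inner_pow hm hb hx 16
  have hK4 : 0 < K ^ 4 := by positivity
  obtain ⟨k1, k2⟩ := integrable_and_integral_le_of_le_half_add (P := P)
    (A := fun ω => Y ω ^ 8 / K ^ 4) (B := fun ω => K ^ 4 * inner ℝ (b ω) x ^ 16)
    (C := fun ω => (Y ω * inner ℝ (b ω) x ^ 2) ^ 4) (α := 8 ^ 8 * K ^ 4)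
    (β := K ^ 4 * gaussMoment) (i1.div_const _) (j1.const_mul _) (by fun_prop)
    (fun ω => by positivity)
    (fun ω => by
      refine (mul_le_half_add_of_pos (A := Y ω ^ 4) (B := inner ℝ (b ω) x ^ 8) hK4).trans' ?_
        |>.trans_eq ?_
      · apply le_of_eq; ring
      · ring)
    (by rw [integral_div, div_le_iff₀ hK4]; refine i2.trans_eq ?_; push_cast; ring)
    (by rw [integral_const_mul, j2, gaussMoment]; gcongr; linarith)
  refine ⟨k1, k2.trans ?_⟩
  have h1 : gaussMoment ≤ gaussMoment ^ 4 := le_self_pow₀ hM (by norm_num)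
  have h2 : 1 ≤ gaussMoment ^ 4 := one_le_pow₀ hM
  have e : (64 * gaussMoment * K) ^ 4 = 8 ^ 8 * gaussMoment ^ 4 * K ^ 4 := by ring
  have e' : (8 ^ 8 * K ^ 4 + K ^ 4 * gaussMoment) / 2 = (8 ^ 8 + gaussMoment) / 2 * K ^ 4 := by ring
  rw [e, e']
  gcongr
  linarith

theorem moment_sq_mul_sq_inner (hm : Measurable b) (hb : P.map b = stdGaussian (Vec n))
    (hx : ‖x‖ = 1) (hY : Measurable Y) (hK : 0 < K) (hYK : psiOneNorm Y P ≤ ENNReal.ofReal K) :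
    Integrable (fun ω => (Y ω ^ 2 * inner ℝ (b ω) x ^ 2) ^ 4) P ∧
      ∫ ω, (Y ω ^ 2 * inner ℝ (b ω) x ^ 2) ^ 4 ∂P ≤ (16 ^ 4 * gaussMoment * K ^ 2) ^ 4 := by
  have hM := one_le_gaussMoment
  obtain ⟨i1, i2⟩ := integrable_pow_and_integral_le_of_psiOneNorm hY hK.le hYK (N := 16)
    (by decide) (by norm_num)
  have j1 := integrable_inner_pow hm hb hx (N := 16) (by decide)
  have j2 := integral_inner_pow hm hb hx 16
  have hK8 : 0 < K ^ 8 := by positivity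
  obtain ⟨k1, k2⟩ := integrable_and_integral_le_of_le_half_add (P := P)
    (A := fun ω => Y ω ^ 16 / K ^ 8) (B := fun ω => K ^ 8 * inner ℝ (b ω) x ^ 16)
    (C := fun ω => (Y ω ^ 2 * inner ℝ (b ω) x ^ 2) ^ 4) (α := 16 ^ 16 * K ^ 8)
    (β := K ^ 8 * gaussMoment) (i1.div_const _) (j1.const_mul _) (by fun_prop)
    (fun ω => by positivity)
    (fun ω => by
      refine (mul_le_half_add_of_pos (A := Y ω ^ 8) (B := inner ℝ (b ω) x ^ 8) hK8).trans' ?_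
        |>.trans_eq ?_
      · apply le_of_eq; ring
      · ring)
    (by rw [integral_div, div_le_iff₀ hK8]; refine i2.trans_eq ?_; push_cast; ring)
    (by rw [integral_const_mul, j2, gaussMoment]; gcongr; linarith)
  refine ⟨k1, k2.trans ?_⟩
  have h1 : gaussMoment ≤ gaussMoment ^ 4 := le_self_pow₀ hM (by norm_num)
  have h2 : 1 ≤ gaussMoment ^ 4 := one_le_pow₀ hM
  have e : (16 ^ 4 * gaussMoment * K ^ 2) ^ 4 = 16 ^ 16 * gaussMoment ^ 4 * K ^ 8 := by ring
  have e' : (16 ^ 16 * K ^ 8 + K ^ 8 * gaussMoment) / 2 =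
    (16 ^ 16 + gaussMoment) / 2 * K ^ 8 := by ring
  rw [e, e']
  gcongr
  linarith

theorem moment_norm_pow_four (hm : Measurable b) (hb : P.map b = stdGaussian (Vec n)) :
    Integrable (fun ω => (‖b ω‖ ^ 4) ^ 4) P ∧
      ∫ ω, (‖b ω‖ ^ 4) ^ 4 ∂P ≤ ((n : ℝ) ^ 2 * gaussMoment) ^ 4 := by
  have hM := one_le_gaussMoment
  have e : ∀ ω, ∀ j, b ω j = inner ℝ (b ω) (EuclideanSpace.single j (1 : ℝ)) := fun ω j => by
    rw [EuclideanSpace.inner_single_right]; simp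
  have hle : ∀ ω, (‖b ω‖ ^ 4) ^ 4 ≤ (n : ℝ) ^ 7 * ∑ j, b ω j ^ 16 := fun ω => by
    have h1 : (‖b ω‖ ^ 4) ^ 4 = (∑ j, b ω j ^ 2) ^ 8 := by
      rw [← EuclideanSpace.real_norm_sq_eq]; ring
    have h2 := pow_sum_le_card_mul_sum_pow (s := Finset.univ) (f := fun j => b ω j ^ 2)
      (fun j _ => sq_nonneg _) 7
    simp only [Finset.card_univ, Fintype.card_fin, ← pow_mul] at h2
    rw [h1]
    exact h2
  have hI : ∀ j, Integrable (fun ω => b ω j ^ 16) P := fun j => by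
    simp only [e]
    exact integrable_inner_pow hm hb (by simp) (by decide)
  have hS : Integrable (fun ω => (n : ℝ) ^ 7 * ∑ j, b ω j ^ 16) P :=
    (integrable_finsetSum _ fun j _ => hI j).const_mul _
  have hi : Integrable (fun ω => (‖b ω‖ ^ 4) ^ 4) P :=
    hS.mono' (by fun_prop) (Filter.Eventually.of_forall fun ω => by
      rw [Real.norm_eq_abs, abs_of_nonneg (by positivity)]; exact hle ω)
  refine ⟨hi, (integral_mono hi hS hle).trans ?_⟩
  rw [integral_const_mul, integral_finsetSum _ fun j _ => hI j]
  have : ∀ j, ∫ ω, b ω j ^ 16 ∂P ≤ gaussMoment := fun j => by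
    simp only [e]
    rw [integral_inner_pow hm hb (by simp), gaussMoment]; linarith
  calc _ ≤ (n : ℝ) ^ 7 * ∑ _j : Fin n, gaussMoment := by gcongr; exact this _
    _ = (n : ℝ) ^ 8 * gaussMoment := by simp; ring
    _ ≤ (n : ℝ) ^ 8 * gaussMoment ^ 4 := by gcongr; exact le_self_pow₀ hM (by norm_num)
    _ = _ := by ring

end

end

/-! ### Centred responses -/

section
variable {m : ℕ} (y : Fin m → ℝ)

theorem sum_sub_empMean (hm : 1 ≤ m) : ∑ i, (y i - empMean y) = 0 := by
  have : (m : ℝ) ≠ 0 := by positivity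
  rw [Finset.sum_sub_distrib, empMean]
  simp
  field_simp
  simp

theorem sum_sq_sub_empMean_le (hm : 1 ≤ m) : ∑ i, (y i - empMean y) ^ 2 ≤ ∑ i, y i ^ 2 := by
  have h0 := sum_sub_empMean y hm
  have : ∀ i, y i ^ 2 = (y i - empMean y) ^ 2 + 2 * empMean y * (y i - empMean y) +
      empMean y ^ 2 := fun i => by ring
  rw [Finset.sum_congr rfl fun i _ => this i, Finset.sum_add_distrib, Finset.sum_add_distrib,
    ← Finset.mul_sum, h0]
  have : 0 ≤ ∑ _i : Fin m, empMean y ^ 2 := Finset.sum_nonneg fun _ _ => sq_nonneg _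
  linarith

theorem sq_empMean_le (hm : 1 ≤ m) : empMean y ^ 2 ≤ (1 / (m : ℝ)) * ∑ i, y i ^ 2 := by
  have hm' : (0 : ℝ) < m := by exact_mod_cast hm
  have h := sq_sum_le_card_mul_sum_sq (s := Finset.univ) (f := y)
  simp only [Finset.card_univ, Fintype.card_fin] at h
  rw [empMean, mul_pow, one_div, inv_pow, inv_mul_le_iff₀ (by positivity)]
  refine h.trans_eq ?_
  field_simp

theorem abs_empMean_le (hm : 1 ≤ m) {B : ℝ} (hB : ∀ i, |y i| ≤ B) : |empMean y| ≤ B := by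
  have hm' : (0 : ℝ) < m := by exact_mod_cast hm
  rw [empMean, abs_mul, abs_of_pos (by positivity), one_div, inv_mul_le_iff₀ hm']
  refine (Finset.abs_sum_le_sum_abs _ _).trans ((Finset.sum_le_sum fun i _ => hB i).trans_eq ?_)
  simp

theorem sum_sq_sub_empMean_mul_le (hm : 1 ≤ m) (g : Fin m → ℝ) {α β γ : ℝ}
    (hα : (1 / (m : ℝ)) * ∑ i, y i ^ 2 ≤ α) (hβ : (1 / (m : ℝ)) * ∑ i, g i ^ 2 ≤ β)
    (hγ : (1 / (m : ℝ)) * ∑ i, y i ^ 2 * g i ^ 2 ≤ γ) :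
    ∑ i, ((y i - empMean y) * g i) ^ 2 ≤ 2 * (γ + α * β) * m := by
  have hm' : (0 : ℝ) < m := by exact_mod_cast hm
  have h1 : ∀ i, ((y i - empMean y) * g i) ^ 2 ≤
      2 * (y i ^ 2 * g i ^ 2) + 2 * empMean y ^ 2 * g i ^ 2 := fun i => by
    nlinarith [sq_nonneg ((y i + empMean y) * g i)]
  refine (Finset.sum_le_sum fun i _ => h1 i).trans ?_
  rw [Finset.sum_add_distrib, ← Finset.mul_sum, ← Finset.mul_sum]
  rw [one_div, inv_mul_le_iff₀ hm'] at hβ hγ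
  have h2 := (sq_empMean_le y hm).trans hα
  have h3 : empMean y ^ 2 * ∑ i, g i ^ 2 ≤ α * (m * β) :=
    mul_le_mul h2 hβ (Finset.sum_nonneg fun _ _ => sq_nonneg _) ((sq_nonneg _).trans h2)
  linarith

/-- The empirical covariance of `y` and `g²` is close to the covariance as soon as the three
sample means are close to the expectations. -/
theorem abs_centered_sub_le (g : Fin m → ℝ) {e₁ e₂ s β κ : ℝ} (hβ : (1 / (m : ℝ)) * ∑ i, g i ^ 2 ≤ β)
    (hκ : |e₁| ≤ κ) (hs : 0 ≤ s)
    (h1 : |(1 / (m : ℝ)) * ∑ i, y i - e₁| ≤ s) (h2 : |(1 / (m : ℝ)) * ∑ i, g i ^ 2 - 1| ≤ s)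
    (h3 : |(1 / (m : ℝ)) * ∑ i, y i * g i ^ 2 - e₂| ≤ s) :
    |(1 / (m : ℝ)) * ∑ i, (y i - empMean y) * g i ^ 2 - (e₂ - e₁ * 1)| ≤ s * (1 + β + κ) := by
  have e : (1 / (m : ℝ)) * ∑ i, (y i - empMean y) * g i ^ 2 - (e₂ - e₁ * 1) =
      ((1 / (m : ℝ)) * ∑ i, y i * g i ^ 2 - e₂) +
      -(((1 / (m : ℝ)) * ∑ i, y i - e₁) * ((1 / (m : ℝ)) * ∑ i, g i ^ 2)) +
      -(e₁ * ((1 / (m : ℝ)) * ∑ i, g i ^ 2 - 1)) := by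
    simp only [sub_mul, Finset.sum_sub_distrib, ← Finset.mul_sum]
    have hy : (1 / (m : ℝ)) * ∑ i, y i = empMean y := rfl
    rw [hy]
    ring
  have hg0 : 0 ≤ (1 / (m : ℝ)) * ∑ i, g i ^ 2 :=
    mul_nonneg (by positivity) (Finset.sum_nonneg fun _ _ => sq_nonneg _)
  have t1 : |((1 / (m : ℝ)) * ∑ i, y i - e₁) * ((1 / (m : ℝ)) * ∑ i, g i ^ 2)| ≤ s * β := by
    rw [abs_mul, abs_of_nonneg hg0]
    exact mul_le_mul h1 hβ hg0 hs
  have t2 : |e₁ * ((1 / (m : ℝ)) * ∑ i, g i ^ 2 - 1)| ≤ κ * s := by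
    rw [abs_mul]
    exact mul_le_mul hκ h2 (abs_nonneg _) ((abs_nonneg _).trans hκ)
  rw [e]
  refine (abs_add_three _ _ _).trans ?_
  rw [abs_neg, abs_neg]
  linarith

end

/-! ### The event on which the data are regular -/

section
variable {Ω Ξ : Type*} [MeasurableSpace Ω] [MeasurableSpace Ξ] {P : Measure Ω}
  [IsProbabilityMeasure P] {m n : ℕ} {a : Fin m → Ω → Vec n} {ξ : Fin m → Ω → Ξ}

theorem IsDesign.map_prodMk_eq (hd : IsDesign P a ξ) (i j : Fin m) :
    P.map (fun ω => (a i ω, ξ i ω)) = P.map (fun ω => (a j ω, ξ j ω)) := by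
  have h := fun i => (indepFun_iff_map_prod_eq_prod_map_map (hd.measurable_vec i).aemeasurable
    (hd.measurable_noise i).aemeasurable).1 (hd.noise_indep i)
  rw [h i, h j, hd.gaussian i, hd.gaussian j, (hd.noise_identDistrib i j).map_eq]

theorem IsDesign.integral_comp_eq (hd : IsDesign P a ξ) {φ : Vec n × Ξ → ℝ} (hφ : Measurable φ)
    (i j : Fin m) : ∫ ω, φ (a i ω, ξ i ω) ∂P = ∫ ω, φ (a j ω, ξ j ω) ∂P := by
  have h := fun i => (hd.measurable_vec i).prodMk (hd.measurable_noise i)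
  rw [← integral_map (h i).aemeasurable hφ.aestronglyMeasurable, hd.map_prodMk_eq i j,
    integral_map (h j).aemeasurable hφ.aestronglyMeasurable]

theorem IsDesign.measureReal_mean_gt_le (hd : IsDesign P a ξ) (hm : 1 ≤ m) {φ : Vec n × Ξ → ℝ}
    (hφ : Measurable φ) {B : ℝ} (hB : 0 < B)
    (h4 : ∀ i, Integrable (fun ω => φ (a i ω, ξ i ω) ^ 4) P ∧
      ∫ ω, φ (a i ω, ξ i ω) ^ 4 ∂P ≤ B ^ 4) :
    P.real {ω | 2 * B < (1 / (m : ℝ)) * ∑ i, φ (a i ω, ξ i ω)} ≤ 48 / m :=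
  measureReal_sum_gt_le hm (hd.indep.comp (fun _ => φ) (fun _ => hφ))
    (fun i => hφ.comp ((hd.measurable_vec i).prodMk (hd.measurable_noise i))) (fun i => (h4 i).1)
    (fun i => hd.integral_comp_eq hφ i ⟨0, hm⟩) hB (fun i => (h4 i).2)

theorem IsDesign.measureReal_abs_mean_sub_ge_le (hd : IsDesign P a ξ) (hm : 1 ≤ m)
    {φ : Vec n × Ξ → ℝ} (hφ : Measurable φ) {B t : ℝ} (ht : 0 < t)
    (h4 : ∀ i, Integrable (fun ω => φ (a i ω, ξ i ω) ^ 4) P ∧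
      ∫ ω, φ (a i ω, ξ i ω) ^ 4 ∂P ≤ B ^ 4) (hBm : (B / t) ^ 4 ≤ m) {μ : ℝ}
    (hμ : ∀ i, ∫ ω, φ (a i ω, ξ i ω) ∂P = μ) :
    P.real {ω | t ≤ |(1 / (m : ℝ)) * ∑ i, φ (a i ω, ξ i ω) - μ|} ≤ 48 / m := by
  have hm' : (0 : ℝ) < m := by exact_mod_cast hm
  refine (measureReal_abs_sum_sub_ge_le hm (hd.indep.comp (fun _ => φ) (fun _ => hφ))
    (fun i => hφ.comp ((hd.measurable_vec i).prodMk (hd.measurable_noise i))) (fun i => (h4 i).1)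
    hμ (fun i => (h4 i).2) ht).trans ?_
  rw [div_le_div_iff₀ (by positivity) hm']
  nlinarith

end

section
variable {Ω Ξ : Type*} [MeasurableSpace Ω] [MeasurableSpace Ξ] {P : Measure Ω}
  [IsProbabilityMeasure P] {m n : ℕ} {a : Fin m → Ω → Vec n} {ξ : Fin m → Ω → Ξ}

theorem measurable_observation {f : ℝ → Ξ → ℝ} (hf : Measurable (Function.uncurry f)) {x : Vec n}
    {b : Ω → Vec n} {η : Ω → Ξ} (hb : Measurable b) (hη : Measurable η) :
    Measurable (observation f x b η) :=
  hf.comp (f := fun ω => ((inner ℝ (b ω) x : ℝ), η ω)) (by fun_prop)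

theorem covariance_observation_eq {Y : Ω → ℝ} {b : Ω → Vec n} {x : Vec n} {K : ℝ}
    (hb : Measurable b) (hg : P.map b = stdGaussian (Vec n)) (hx : ‖x‖ = 1) (hY : Measurable Y)
    (hK : 0 < K) (hYK : psiOneNorm Y P ≤ ENNReal.ofReal K) :
    cov[Y, fun ω => inner ℝ (b ω) x ^ 2; P] =
      (∫ ω, Y ω * inner ℝ (b ω) x ^ 2 ∂P) - (∫ ω, Y ω ∂P) * 1 := by
  have h1 : MemLp Y 2 P := (memLp_two_iff_integrable_sq hY.aestronglyMeasurable).2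
    (integrable_pow_and_integral_le_of_psiOneNorm hY hK.le hYK (by decide) (by norm_num)).1
  have h2 : MemLp (fun ω => (inner ℝ (b ω) x : ℝ) ^ 2) 2 P := by
    rw [memLp_two_iff_integrable_sq (by fun_prop)]
    simpa [← pow_mul] using integrable_inner_pow hb hg hx (N := 4) (by decide)
  rw [covariance_eq_sub h1 h2, integral_inner_pow hb hg hx, integral_sq_gaussianReal]
  rfl

/-- In terms of the covariance `ν` this is a lower bound on `K`: errors proportional to `ν`, or not
scaling with the response at all, are dominated by errors proportional to `K`. -/
theorem covariance_le_of_psiOneNorm {Y : Ω → ℝ} {b : Ω → Vec n} {x : Vec n} {K : ℝ}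
    (hb : Measurable b) (hg : P.map b = stdGaussian (Vec n)) (hx : ‖x‖ = 1) (hY : Measurable Y)
    (hK : 0 < K) (hYK : psiOneNorm Y P ≤ ENNReal.ofReal K) :
    cov[Y, fun ω => inner ℝ (b ω) x ^ 2; P] ≤ 68 * gaussMoment * K := by
  rw [covariance_observation_eq hb hg hx hY hK hYK]
  have hM := one_le_gaussMoment
  have h1 := moment_mul_sq_inner hb hg hx hY hK hYK
  have h2 := integrable_pow_and_integral_le_of_psiOneNorm hY hK.le hYK (N := 4)
    (by decide) (by norm_num)
  have h3 := (abs_le.1 (abs_integral_le_of_pow_four (by fun_prop) h1.1 (by positivity) h1.2)).2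
  have h4 := (abs_le.1 (abs_integral_le_of_pow_four hY h2.1 (B := 4 * K) (by positivity)
    (by exact_mod_cast h2.2))).1
  nlinarith

/-- The regularity conditions on the components `aᵢᵀ x` and on the noise under which the weights
`yᵢ - ȳ` satisfy the hypotheses of the concentration inequalities. -/
def regularSet (m : ℕ) (f : ℝ → Ξ → ℝ) (K : ℝ) : Set (Fin m → ℝ × Ξ) :=
  {W | (1 / (m : ℝ)) * ∑ i, f (W i).1 (W i).2 ^ 2 ≤ 2 * (8 * K) ^ 2 ∧
    (1 / (m : ℝ)) * ∑ i, (W i).1 ^ 2 ≤ 2 * gaussMoment ∧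
    (1 / (m : ℝ)) * ∑ i, f (W i).1 (W i).2 ^ 2 * (W i).1 ^ 2 ≤ 2 * (16 ^ 4 * gaussMoment * K ^ 2) ∧
    ∀ i, |f (W i).1 (W i).2| ≤ 3 * (2 * Real.log m) * K}

theorem measurableSet_regularSet {f : ℝ → Ξ → ℝ} (hf : Measurable (Function.uncurry f)) (K : ℝ) :
    MeasurableSet (regularSet m f K) := by
  have h1 : ∀ i, Measurable fun W : Fin m → ℝ × Ξ => f (W i).1 (W i).2 := fun i =>
    hf.comp (measurable_pi_apply i)
  have g1 : Measurable fun W : Fin m → ℝ × Ξ => (1 / (m : ℝ)) * ∑ i, f (W i).1 (W i).2 ^ 2 := by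
    fun_prop
  have g2 : Measurable fun W : Fin m → ℝ × Ξ => (1 / (m : ℝ)) * ∑ i, (W i).1 ^ 2 := by
    fun_prop
  have g3 : Measurable fun W : Fin m → ℝ × Ξ =>
      (1 / (m : ℝ)) * ∑ i, f (W i).1 (W i).2 ^ 2 * (W i).1 ^ 2 := by
    fun_prop
  have h4 : MeasurableSet {W : Fin m → ℝ × Ξ |
      ∀ i, |f (W i).1 (W i).2| ≤ 3 * (2 * Real.log m) * K} := by
    simp only [Set.ofPred_forall]
    exact MeasurableSet.iInter fun i =>
      measurableSet_le (continuous_abs.measurable.comp (h1 i)) measurable_const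
  exact (measurableSet_le g1 measurable_const).inter ((measurableSet_le g2 measurable_const).inter
    ((measurableSet_le g3 measurable_const).inter h4))

theorem IsDesign.measureReal_not_regular_le (hd : IsDesign P a ξ) {x : Vec n} (hx : ‖x‖ = 1)
    (hm : 2 ≤ m) {f : ℝ → Ξ → ℝ} (hf : Measurable (Function.uncurry f)) {K : ℝ} (hK : 0 < K)
    (hYK : ∀ i, psiOneNorm (observation f x (a i) (ξ i)) P ≤ ENNReal.ofReal K) :
    P.real {ω | (fun i => ((inner ℝ (a i ω) x : ℝ), ξ i ω)) ∉ regularSet m f K} ≤ 145 / m := by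
  have hm1 : 1 ≤ m := by omega
  have hm' : (0 : ℝ) < m := by positivity
  have hM := one_le_gaussMoment
  have hYm : ∀ i, Measurable (observation f x (a i) (ξ i)) := fun i =>
    measurable_observation hf (hd.measurable_vec i) (hd.measurable_noise i)
  have hφ : Measurable fun z : Vec n × Ξ => f (inner ℝ z.1 x) z.2 :=
    hf.comp (f := fun z : Vec n × Ξ => ((inner ℝ z.1 x : ℝ), z.2)) (by fun_prop)
  have e1 := hd.measureReal_mean_gt_le hm1 (φ := fun z => f (inner ℝ z.1 x) z.2 ^ 2)
    (by fun_prop) (B := (8 * K) ^ 2) (by positivity) fun i => by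
      have := integrable_pow_and_integral_le_of_psiOneNorm (hYm i) hK.le (hYK i) (N := 8)
        (by decide) (by norm_num)
      simp only [observation] at this
      simpa [← pow_mul] using this
  have e2 := hd.measureReal_mean_gt_le hm1 (φ := fun z => inner ℝ z.1 x ^ 2)
    (by fun_prop) (B := gaussMoment) (by positivity) fun i => by
      simp only [← pow_mul]
      refine ⟨integrable_inner_pow (hd.measurable_vec i) (hd.gaussian i) hx (by decide), ?_⟩
      rw [integral_inner_pow (hd.measurable_vec i) (hd.gaussian i) hx]
      exact integral_pow_eight_le.trans (le_self_pow₀ hM (by norm_num))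
  have e3 := hd.measureReal_mean_gt_le hm1
    (φ := fun z => f (inner ℝ z.1 x) z.2 ^ 2 * inner ℝ z.1 x ^ 2)
    (by fun_prop) (B := 16 ^ 4 * gaussMoment * K ^ 2) (by positivity) fun i =>
      moment_sq_mul_sq_inner (hd.measurable_vec i) (hd.gaussian i) hx (hYm i) hK (hYK i)
  have hlog : 1 ≤ 2 * Real.log m := by
    have h2 : Real.log 2 ≤ Real.log m := Real.log_le_log (by norm_num) (by exact_mod_cast hm)
    linarith [Real.log_two_gt_d9]
  have e4 := measureReal_finset_biUnion_le (P := P) Finset.univ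
    (fun i => {ω | 3 * (2 * Real.log m) * K < |observation f x (a i) (ξ i) ω|})
    (c := Real.exp (-(2 * Real.log m)))
    (fun i _ => measureReal_abs_gt_le_of_psiOneNorm (hYm i) hK (hYK i) hlog)
  have hexp : (m : ℝ) * Real.exp (-(2 * Real.log m)) = 1 / m := by
    rw [Real.exp_neg, two_mul, Real.exp_add, Real.exp_log hm']
    field_simp
  rw [Finset.card_univ, Fintype.card_fin, hexp] at e4
  refine (measureReal_le_add_of_subset_union e1 (measureReal_le_add_of_subset_union e2
    (measureReal_le_add_of_subset_union e3 e4 subset_rfl) subset_rfl) fun ω hω => ?_).trans_eq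
    (by ring)
  by_contra hcon
  apply hω
  simp only [Set.mem_union, Set.mem_ofPred_eq, not_or, not_lt, not_exists, not_and,
    Finset.mem_univ, true_implies] at hcon
  exact hcon

/-- The complement of a measurable hull: the set `S` itself need not be measurable. -/
theorem exists_measurableSet_of_measureReal_le {S : Set Ω} {c : ℝ} (h : P.real S ≤ c) :
    ∃ A : Set Ω, MeasurableSet A ∧ 1 - c ≤ P.real A ∧ ∀ ω ∈ A, ω ∉ S := by
  refine ⟨(toMeasurable P S)ᶜ, (measurableSet_toMeasurable P _).compl, ?_,
    fun ω hω h' => hω (subset_toMeasurable P _ h')⟩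
  rw [probReal_compl_eq_one_sub (measurableSet_toMeasurable P _), measureReal_def,
    measure_toMeasurable, ← measureReal_def]
  exact sub_le_sub_left h 1

/-- The event on which all the empirical quantities are close to their expectations on the finite
set `F` of directions. The form with weights `yᵢ - ȳ` has in the direction of `x` an additional
error `τ`, of which no rate is required. -/
theorem IsDesign.exists_regular_event (hd : IsDesign P a ξ) {x : Vec n} (hx : ‖x‖ = 1)
    (hm : 2 ≤ m) {f : ℝ → Ξ → ℝ} (hf : Measurable (Function.uncurry f)) {K ν τ D : ℝ} (hK : 0 < K)
    (hYK : ∀ i, psiOneNorm (observation f x (a i) (ξ i)) P ≤ ENNReal.ofReal K)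
    (hν : ∀ i, cov[observation f x (a i) (ξ i), fun ω => (inner ℝ (a i ω) x) ^ 2; P] = ν)
    (hτ : 0 < τ)
    (hmτ : (64 * gaussMoment * (1 + K) * (1 + 2 * gaussMoment + 4 * K) / τ) ^ 4 ≤ m)
    (hD : 0 ≤ D) (F : Finset (Vec n)) :
    ∃ A : Set Ω, MeasurableSet A ∧
      1 - (337 / m + (F.card : ℝ) ^ 2 * (12 * Real.exp (-D))) ≤ P.real A ∧
      ∀ ω ∈ A, ∀ y : Fin m → ℝ, y = (fun i => observation f x (a i) (ξ i) ω) →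
        (∀ u ∈ F, ∀ v ∈ F,
          |empForm (fun i => a i ω) (fun i => y i - empMean y) u v -
            ν * (inner ℝ x u * inner ℝ x v)| ≤
          (1 / m) * (2 * √(2 * (262656 * gaussMoment * K ^ 2 * m) * D) +
            (6 * √(128 * K ^ 2 * m * D) + 24 * (12 * K * Real.log m) * D)) * (‖u‖ * ‖v‖) +
            τ * |inner ℝ x u * inner ℝ x v|) ∧
        (∀ u ∈ F, ∀ v ∈ F, |empForm (fun i => a i ω) 1 u v - inner ℝ u v| ≤
          (1 / m) * (6 * √(m * D) + 24 * 1 * D) * (‖u‖ * ‖v‖)) ∧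
        (1 / (m : ℝ)) * ∑ i, (y i - empMean y) ^ 2 ≤ 128 * K ^ 2 ∧
        (1 / (m : ℝ)) * ∑ i, ‖a i ω‖ ^ 4 ≤ 2 * ((n : ℝ) ^ 2 * gaussMoment) := by
  have hm1 : 1 ≤ m := by omega
  have hm' : (0 : ℝ) < m := by positivity
  have hM := one_le_gaussMoment
  have hn : 1 ≤ n := by
    rcases Nat.eq_zero_or_pos n with rfl | h
    · rw [Subsingleton.elim x 0] at hx; simp at hx
    · exact h
  have hlogm : 0 < Real.log m := Real.log_pos (by exact_mod_cast hm)
  have hYm : ∀ i, Measurable (observation f x (a i) (ξ i)) := fun i =>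
    measurable_observation hf (hd.measurable_vec i) (hd.measurable_noise i)
  have hφ : Measurable fun z : Vec n × Ξ => f (inner ℝ z.1 x) z.2 :=
    hf.comp (f := fun z : Vec n × Ξ => ((inner ℝ z.1 x : ℝ), z.2)) (by fun_prop)
  set s : ℝ := τ / (1 + 2 * gaussMoment + 4 * K) with hs
  have hs0 : 0 < s := by positivity
  have hBm : ∀ B, 0 ≤ B → B ≤ 64 * gaussMoment * (1 + K) → (B / s) ^ 4 ≤ m := fun B hB0 hB => by
    refine le_trans ?_ hmτ
    have : 64 * gaussMoment * (1 + K) * (1 + 2 * gaussMoment + 4 * K) / τ =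
        64 * gaussMoment * (1 + K) / s := by rw [hs]; field_simp
    rw [this]
    gcongr
  set i₀ : Fin m := ⟨0, hm1⟩
  have m1 := fun i => integrable_pow_and_integral_le_of_psiOneNorm (hYm i) hK.le (hYK i) (N := 4)
    (by decide) (by norm_num)
  have b1 := hd.measureReal_not_regular_le hx hm hf hK hYK
  have b2 := hd.measureReal_mean_gt_le hm1 (φ := fun z => ‖z.1‖ ^ 4) (by fun_prop)
    (B := (n : ℝ) ^ 2 * gaussMoment) (by positivity)
    fun i => moment_norm_pow_four (hd.measurable_vec i) (hd.gaussian i)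
  have b3 := hd.measureReal_abs_mean_sub_ge_le hm1 (φ := fun z => f (inner ℝ z.1 x) z.2) hφ
    (B := 4 * K) hs0 (fun i => by exact_mod_cast m1 i) (hBm _ (by positivity) (by nlinarith))
    (fun i => hd.integral_comp_eq hφ i i₀)
  have b4 := hd.measureReal_abs_mean_sub_ge_le hm1 (φ := fun z => inner ℝ z.1 x ^ 2) (by fun_prop)
    (B := gaussMoment) hs0 (fun i => by
      simp only [← pow_mul]
      refine ⟨integrable_inner_pow (hd.measurable_vec i) (hd.gaussian i) hx (by decide), ?_⟩
      rw [integral_inner_pow (hd.measurable_vec i) (hd.gaussian i) hx]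
      exact integral_pow_eight_le.trans (le_self_pow₀ hM (by norm_num)))
    (hBm _ (by positivity) (by nlinarith)) (μ := 1)
    (fun i => by
      rw [integral_inner_pow (hd.measurable_vec i) (hd.gaussian i) hx, integral_sq_gaussianReal])
  have b5 := hd.measureReal_abs_mean_sub_ge_le hm1
    (φ := fun z => f (inner ℝ z.1 x) z.2 * inner ℝ z.1 x ^ 2) (by fun_prop)
    (B := 64 * gaussMoment * K) hs0
    (fun i => moment_mul_sq_inner (hd.measurable_vec i) (hd.gaussian i) hx (hYm i) hK (hYK i))
    (hBm _ (by positivity) (by nlinarith))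
    (fun i => hd.integral_comp_eq (φ := fun z => f (inner ℝ z.1 x) z.2 * inner ℝ z.1 x ^ 2)
      (by fun_prop) i i₀)
  -- The bounds on the weights, as they enter the concentration inequalities.
  have hreg : ∀ W ∈ regularSet m f K, ∀ y : Fin m → ℝ, y = (fun i => f (W i).1 (W i).2) →
      ∑ i, (y i - empMean y) ^ 2 ≤ 128 * K ^ 2 * m ∧ (∀ i, |y i - empMean y| ≤ 12 * K * Real.log m) ∧
      ∑ i, ((y i - empMean y) * (W i).1) ^ 2 ≤ 262656 * gaussMoment * K ^ 2 * m := by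
    rintro W ⟨h1, h2, h3, h4⟩ y rfl
    refine ⟨?_, fun i => ?_, ?_⟩
    · refine (sum_sq_sub_empMean_le _ hm1).trans ?_
      rw [one_div, inv_mul_le_iff₀ hm'] at h1
      linarith
    · refine (abs_sub _ _).trans ?_
      linarith [h4 i, abs_empMean_le _ hm1 h4]
    · refine (sum_sq_sub_empMean_mul_le _ hm1 _ h1 h2 h3).trans_eq ?_
      ring
  have b6 := hd.measureReal_weighted_gt_le hx
    (fun W i => f (W i).1 (W i).2 - empMean (fun j => f (W j).1 (W j).2))
    (fun i => by
      have h1 : ∀ i, Measurable fun W : Fin m → ℝ × Ξ => f (W i).1 (W i).2 := fun i =>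
        hf.comp (measurable_pi_apply i)
      unfold empMean
      fun_prop)
    (measurableSet_regularSet hf K) (V := 128 * K ^ 2 * m)
    (V' := 262656 * gaussMoment * K ^ 2 * m) (B := 12 * K * Real.log m) (by positivity)
    (by positivity) (by positivity) hD (fun W => sum_sub_empMean _ hm1)
    (fun W hW => (hreg W hW _ rfl).1) (fun W hW => (hreg W hW _ rfl).2.1)
    (fun W hW => (hreg W hW _ rfl).2.2) F
  have b7 := measureReal_isotropic_gt_le hd.iIndepFun_vec hd.measurable_vec hd.gaussian hm'
    one_pos hD (fun _ => 1) (by simp) (by simp) F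
  have hbad := measureReal_le_add_of_subset_union b1 (measureReal_le_add_of_subset_union b2
    (measureReal_le_add_of_subset_union b3 (measureReal_le_add_of_subset_union b4
    (measureReal_le_add_of_subset_union b5 (measureReal_le_add_of_subset_union b6 b7 subset_rfl)
      subset_rfl) subset_rfl) subset_rfl) subset_rfl) subset_rfl
  have he₁ : |∫ ω, f (inner ℝ (a i₀ ω) x) (ξ i₀ ω) ∂P| ≤ 4 * K :=
    abs_integral_le_of_pow_four (hYm i₀) (m1 i₀).1 (by positivity) (by exact_mod_cast (m1 i₀).2)
  obtain ⟨A, hA, hPA, hAω⟩ := exists_measurableSet_of_measureReal_le hbad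
  refine ⟨A, hA, (sub_le_sub_left (le_of_eq ?_) 1).trans hPA, ?_⟩
  · ring
  · intro ω hω y hy
    have hω' := hAω ω hω
    clear b1 b2 b3 b4 b5 b6 b7 hbad hAω
    simp only [Set.mem_union, not_or] at hω'
    obtain ⟨c1, c2, c3, c4, c5, c6, c7⟩ := hω'
    simp only [Set.mem_ofPred_eq, not_not, not_lt, not_le] at c1 c2 c3 c4 c5
    have hy' : y = fun i => f (inner ℝ (a i ω) x) (ξ i ω) := hy
    have r := hreg _ c1 y hy'
    refine ⟨fun u hu v hv => ?_, fun u hu v hv => ?_, ?_, c2⟩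
    · have hcen := abs_centered_sub_le y (fun i => (inner ℝ (a i ω) x : ℝ)) c1.2.1 he₁ hs0.le
        (by rw [hy']; exact c3.le) c4.le (by rw [hy']; exact c5.le)
      have hsτ : s * (1 + 2 * gaussMoment + 4 * K) = τ := by rw [hs]; field_simp
      rw [hsτ] at hcen
      have hνe := hν i₀
      rw [covariance_observation_eq (hd.measurable_vec i₀) (hd.gaussian i₀) hx (hYm i₀) hK
        (hYK i₀)] at hνe
      have hνe' : (∫ ω, f (inner ℝ (a i₀ ω) x) (ξ i₀ ω) * inner ℝ (a i₀ ω) x ^ 2 ∂P) -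
        (∫ ω, f (inner ℝ (a i₀ ω) x) (ξ i₀ ω) ∂P) * 1 = ν := hνe
      rw [hνe'] at hcen
      have hT : ¬ _ := fun h => c6 ⟨c1, (u, v), Finset.mk_mem_product hu hv, h⟩
      rw [not_lt] at hT
      have hyi : ∀ i, f (inner ℝ (a i ω) x) (ξ i ω) = y i := fun i => (congrFun hy' i).symm
      simp only [hyi] at hT
      have e : empForm (fun i => a i ω) (fun i => y i - empMean y) u v -
          ν * (inner ℝ x u * inner ℝ x v) =
          (1 / (m : ℝ)) * (∑ i, (y i - empMean y) * (inner ℝ (a i ω) u * inner ℝ (a i ω) v) -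
            inner ℝ x u * inner ℝ x v * ∑ i, (y i - empMean y) * inner ℝ (a i ω) x ^ 2) +
          ((1 / (m : ℝ)) * ∑ i, (y i - empMean y) * inner ℝ (a i ω) x ^ 2 - ν) *
            (inner ℝ x u * inner ℝ x v) := by
        rw [empForm]; ring
      rw [e]
      refine (abs_add_le _ _).trans (add_le_add ?_ ?_)
      · rw [abs_mul, abs_of_pos (show (0 : ℝ) < 1 / m by positivity), mul_assoc (1 / (m : ℝ))]
        exact mul_le_mul_of_nonneg_left hT (by positivity)
      · rw [abs_mul]
        gcongr
    · have hT : ¬ _ := fun h => c7 ⟨(u, v), Finset.mk_mem_product hu hv, h⟩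
      rw [not_lt] at hT
      have e : empForm (fun i => a i ω) 1 u v - inner ℝ u v = (1 / (m : ℝ)) *
          ∑ i, (1 : ℝ) * (inner ℝ (a i ω) u * inner ℝ (a i ω) v - inner ℝ u v) := by
        simp only [empForm, one_mul, Pi.one_apply, Finset.sum_sub_distrib]
        simp
        field_simp
      rw [e, abs_mul, abs_of_pos (show (0 : ℝ) < 1 / m by positivity), mul_assoc (1 / (m : ℝ))]
      exact mul_le_mul_of_nonneg_left hT (by positivity)
    · rw [one_div, inv_mul_le_iff₀ hm']
      linarith [r.1]

end

/-! ### The size of the net against the sample size -/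

theorem log_pow_four_le {m : ℝ} (hm : 1 ≤ m) : Real.log m ^ 4 ≤ 64 * m * Real.log m := by
  have h0 : 0 ≤ Real.log m := Real.log_nonneg hm
  have h1 : Real.log m ≤ m ^ (1 / 3 : ℝ) / (1 / 3) :=
    Real.log_le_rpow_div (by linarith) (by norm_num)
  have h2 : Real.log m ^ 3 ≤ (m ^ (1 / 3 : ℝ) / (1 / 3)) ^ 3 := by gcongr
  have h3 : (m ^ (1 / 3 : ℝ)) ^ 3 = m := by
    rw [← Real.rpow_natCast, ← Real.rpow_mul (by linarith)]
    norm_num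
  rw [div_pow, h3] at h2
  have h4 : Real.log m ^ 3 ≤ 64 * m := by norm_num at h2; linarith
  calc Real.log m ^ 4 = Real.log m ^ 3 * Real.log m := by ring
    _ ≤ _ := by gcongr

/-- The logarithmic size `D` of the net at scale `e² / n`, where `e` is the statistical error.
The second bound is where the choice of the scale matters: `log (1 / e)` is absorbed by a
factor `e`, whereas it could be as large as `log m`. -/
theorem log_card_bounds {m k : ℕ} (hm : 2 ≤ m) (hk : 1 ≤ k) {R e c D : ℝ} (hR : 2 ≤ R)
    (he0 : 0 < e) (he1 : e ≤ 1 / 2) (he : m * e ^ 2 = k * Real.log R * Real.log m) (hc : 1 ≤ c)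
    (hcard : c ≤ (1 + 2 * R / e ^ 2) ^ k) (hD : D = 2 * Real.log (2 * c) + Real.log m) :
    0 ≤ D ∧ D ≤ 23 * (m * e ^ 2) ∧ D * Real.log m ≤ 20 * (m * e) := by
  have hm' : (2 : ℝ) ≤ m := by exact_mod_cast hm
  have hk' : (1 : ℝ) ≤ k := by exact_mod_cast hk
  have hl2 := Real.log_two_gt_d9
  have hl2' := Real.log_two_lt_d9
  have hℓ : Real.log 2 ≤ Real.log R := Real.log_le_log (by norm_num) hR
  have hM : Real.log 2 ≤ Real.log m := Real.log_le_log (by norm_num) hm'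
  set ℓ := Real.log R
  set M := Real.log m
  set q := Real.log (1 / e) with hq
  have hq1 : q ≤ 1 / e := (Real.log_le_sub_one_of_pos (by positivity)).trans (by linarith)
  have hq0 : 0 ≤ q := Real.log_nonneg (by rw [le_div_iff₀ he0]; linarith)
  have hkℓ : Real.log 2 ≤ k * ℓ := by nlinarith
  -- `1 / e² = m / κ ≤ 4 m`
  have hκ : 1 / 4 ≤ k * ℓ * M := by nlinarith
  have hinv : 1 / e ^ 2 ≤ 4 * m := by
    rw [div_le_iff₀ (by positivity)]; linarith
  have hqM : 2 * q ≤ 3 * M := by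
    have h1 : 2 * q = Real.log (1 / e ^ 2) := by
      rw [hq, one_div, one_div, Real.log_inv, Real.log_inv, Real.log_pow]; push_cast; ring
    have h2 : Real.log (4 * m) = 2 * Real.log 2 + M := by
      rw [show (4 : ℝ) = 2 ^ 2 by norm_num, Real.log_mul (by norm_num) (by positivity),
        Real.log_pow]
      push_cast; ring
    have := Real.log_le_log (by positivity) hinv
    linarith
  have hlogc : Real.log c ≤ k * (3 * ℓ + 2 * q) := by
    have h1 : 1 + 2 * R / e ^ 2 ≤ 2 ^ 2 * R * (1 / e) ^ 2 := by
      have : 1 ≤ R / e ^ 2 := by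
        rw [le_div_iff₀ (by positivity)]; nlinarith
      have h3 : 2 ^ 2 * R * (1 / e) ^ 2 = 4 * (R / e ^ 2) := by field_simp; norm_num
      rw [h3, mul_div_assoc]; linarith
    have h2 := Real.log_le_log (by linarith) hcard
    rw [Real.log_pow] at h2
    refine h2.trans (mul_le_mul_of_nonneg_left ?_ (by linarith))
    refine (Real.log_le_log (by positivity) h1).trans ?_
    rw [Real.log_mul (by positivity) (by positivity), Real.log_mul (by norm_num) (by positivity),
      Real.log_pow, Real.log_pow]
    push_cast
    linarith
  have hDle : D ≤ 8 * (k * ℓ) + 4 * (k * q) + M := by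
    rw [hD, Real.log_mul (by norm_num) (by positivity)]
    linarith
  have hD0 : 0 ≤ D := by
    rw [hD]
    have : 0 ≤ Real.log (2 * c) := Real.log_nonneg (by linarith)
    linarith
  have hM0 : 0 ≤ M := by linarith
  have hMk : M ≤ k * M := le_mul_of_one_le_left hM0 hk'
  have hkM : k * M ≤ 3 / 2 * (k * ℓ * M) := by
    have := mul_le_mul_of_nonneg_left hℓ (by linarith : 0 ≤ k * M)
    nlinarith
  refine ⟨hD0, ?_, ?_⟩
  · have h1 : k * ℓ ≤ 3 / 2 * (k * ℓ * M) := by nlinarith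
    have h3 : 2 * (k * q) ≤ 3 * (k * M) := by nlinarith
    rw [he]
    linarith
  · have h1 : D * M ≤ (8 * (k * ℓ) + 4 * (k * q) + M) * M := by
      gcongr
    have h2 : k * ℓ * M ≤ m * e / 2 := by
      have := mul_le_mul_of_nonneg_left he1 (by positivity : 0 ≤ m * e)
      rw [← he]; linarith
    have h3 : k * q * M ≤ 3 / 2 * (m * e) := by
      have h4 : k * M * q ≤ 3 / 2 * (m * e ^ 2) * (1 / e) := by
        rw [he]
        exact mul_le_mul hkM hq1 hq0 (by nlinarith)
      have h5 : 3 / 2 * (m * e ^ 2) * (1 / e) = 3 / 2 * (m * e) := by field_simp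
      linarith
    have h6 : M ^ 2 ≤ 10 * (m * e) := by
      refine le_of_sq_le_sq ?_ (by positivity)
      have h7 := log_pow_four_le (m := m) (by linarith)
      have h8 : M ≤ 3 / 2 * (m * e ^ 2) := by rw [he]; linarith
      have h9 : 64 * m * M ≤ 64 * m * (3 / 2 * (m * e ^ 2)) := by gcongr
      have h10 : 0 ≤ (m * e) ^ 2 := by positivity
      have h11 : M ^ 4 ≤ 64 * m * M := h7
      linarith
    linarith

/-- Under the bounds of `log_card_bounds` the deviations of the empirical forms are of order `e`. -/
theorem deviation_bounds {m : ℕ} (hm : 1 ≤ m) {e D K l g : ℝ} (he0 : 0 < e) (he1 : e ≤ 1 / 2)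
    (hK : 0 < K) (hg : 1 ≤ g) (hD0 : 0 ≤ D) (hD : D ≤ 23 * (m * e ^ 2))
    (hDl : D * l ≤ 20 * (m * e)) :
    (1 / m) * (2 * √(2 * (262656 * g * K ^ 2 * m) * D) +
      (6 * √(128 * K ^ 2 * m * D) + 24 * (12 * K * l) * D)) ≤ 14000 * g * K * e ∧
    (1 / m) * (6 * √(m * D) + 24 * 1 * D) ≤ 306 * e := by
  have hm' : (0 : ℝ) < m := by positivity
  have hmD : m * D ≤ 23 * (m * e) ^ 2 := by nlinarith
  have s1 : √(2 * (262656 * g * K ^ 2 * m) * D) ≤ 3640 * g * K * (m * e) := by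
    rw [Real.sqrt_le_left (by positivity)]
    have h1 : 2 * (262656 * g * K ^ 2 * m) * D = 525312 * g * K ^ 2 * (m * D) := by ring
    have h2 : 525312 * g * K ^ 2 * (m * D) ≤ 525312 * g * K ^ 2 * (23 * (m * e) ^ 2) := by gcongr
    have h3 : g * (K ^ 2 * (m * e) ^ 2) ≤ g ^ 2 * (K ^ 2 * (m * e) ^ 2) := by
      gcongr; nlinarith
    have h4 : 0 ≤ g ^ 2 * (K ^ 2 * (m * e) ^ 2) := by positivity
    nlinarith
  have s2 : √(128 * K ^ 2 * m * D) ≤ 60 * K * (m * e) := by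
    rw [Real.sqrt_le_left (by positivity)]
    have h2 : 128 * K ^ 2 * (m * D) ≤ 128 * K ^ 2 * (23 * (m * e) ^ 2) := by gcongr
    have h4 : 0 ≤ K ^ 2 * (m * e) ^ 2 := by positivity
    nlinarith
  have s3 : √(m * D) ≤ 5 * (m * e) := by
    rw [Real.sqrt_le_left (by positivity)]
    nlinarith [sq_nonneg (m * e)]
  constructor
  · rw [one_div, inv_mul_le_iff₀ hm']
    have h1 := mul_le_mul_of_nonneg_left hDl hK.le
    have h2 : K * (m * e) ≤ g * K * (m * e) := by
      gcongr; nlinarith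
    nlinarith
  · rw [one_div, inv_mul_le_iff₀ hm']
    have : m * e ^ 2 ≤ m * e / 2 := by nlinarith [mul_pos hm' he0]
    nlinarith

/-! ### From the net to the whole range -/

/-- The operator bound on the empirical form, by the Cauchy-Schwarz inequality. -/
theorem abs_empForm_le {m n : ℕ} (a : Fin m → Vec n) (w : Fin m → ℝ) {A B : ℝ} (hA : 0 ≤ A)
    (hB : 0 ≤ B) (hw : (1 / (m : ℝ)) * ∑ i, w i ^ 2 ≤ A ^ 2)
    (ha : (1 / (m : ℝ)) * ∑ i, ‖a i‖ ^ 4 ≤ B ^ 2) (u v : Vec n) :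
    |empForm a w u v| ≤ A * B * (‖u‖ * ‖v‖) := by
  have h1 : |∑ i, w i * (inner ℝ (a i) u * inner ℝ (a i) v)| ≤
      (∑ i, |w i| * ‖a i‖ ^ 2) * (‖u‖ * ‖v‖) := by
    rw [Finset.sum_mul]
    refine (Finset.abs_sum_le_sum_abs _ _).trans (Finset.sum_le_sum fun i _ => ?_)
    rw [abs_mul, abs_mul, mul_assoc]
    refine mul_le_mul_of_nonneg_left ?_ (abs_nonneg _)
    calc _ ≤ (‖a i‖ * ‖u‖) * (‖a i‖ * ‖v‖) :=
          mul_le_mul (abs_real_inner_le_norm _ _) (abs_real_inner_le_norm _ _) (abs_nonneg _)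
            (by positivity)
      _ = _ := by ring
  have h2 : ((1 / (m : ℝ)) * ∑ i, |w i| * ‖a i‖ ^ 2) ^ 2 ≤ (A * B) ^ 2 := by
    have h3 := Finset.sum_mul_sq_le_sq_mul_sq Finset.univ (fun i => |w i|) (fun i => ‖a i‖ ^ 2)
    simp only [sq_abs, ← pow_mul] at h3
    calc _ = (1 / (m : ℝ)) ^ 2 * (∑ i, |w i| * ‖a i‖ ^ 2) ^ 2 := by ring
      _ ≤ (1 / (m : ℝ)) ^ 2 * ((∑ i, w i ^ 2) * ∑ i, ‖a i‖ ^ 4) := by gcongr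
      _ = ((1 / (m : ℝ)) * ∑ i, w i ^ 2) * ((1 / (m : ℝ)) * ∑ i, ‖a i‖ ^ 4) := by ring
      _ ≤ A ^ 2 * B ^ 2 := by
        refine mul_le_mul hw ha ?_ (by positivity)
        exact mul_nonneg (by positivity) (Finset.sum_nonneg fun i _ => by positivity)
      _ = _ := by ring
  have h4 := le_of_sq_le_sq h2 (by positivity)
  rw [empForm, abs_mul, abs_of_nonneg (show (0 : ℝ) ≤ 1 / m by positivity)]
  calc _ ≤ (1 / (m : ℝ)) * ((∑ i, |w i| * ‖a i‖ ^ 2) * (‖u‖ * ‖v‖)) := by gcongr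
    _ = ((1 / (m : ℝ)) * ∑ i, |w i| * ‖a i‖ ^ 2) * (‖u‖ * ‖v‖) := by ring
    _ ≤ _ := mul_le_mul_of_nonneg_right h4 (by positivity)

theorem empForm_sub_left {m n : ℕ} (a : Fin m → Vec n) (w : Fin m → ℝ) (u u' v : Vec n) :
    empForm a w (u - u') v = empForm a w u v - empForm a w u' v := by
  simp only [empForm, ← mul_sub, ← Finset.sum_sub_distrib, inner_sub_right, sub_mul]

theorem empForm_sub_right {m n : ℕ} (a : Fin m → Vec n) (w : Fin m → ℝ) (u v v' : Vec n) :
    empForm a w u (v - v') = empForm a w u v - empForm a w u v' := by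
  simp only [empForm, ← mul_sub, ← Finset.sum_sub_distrib, inner_sub_right]

/-- Perturbation of both arguments of a bounded bilinear form. -/
theorem abs_le_add_of_bilinear {n : ℕ} {B : Vec n → Vec n → ℝ} {Λ η : ℝ}
    (hl : ∀ u u' v, B (u - u') v = B u v - B u' v) (hr : ∀ u v v', B u (v - v') = B u v - B u v')
    (hΛ : 0 ≤ Λ) (hη : 0 ≤ η) (hB : ∀ u v, |B u v| ≤ Λ * (‖u‖ * ‖v‖)) {u q v v' : Vec n}
    (hu : ‖u - q‖ ≤ η) (hv : ‖v - v'‖ ≤ η) (hq : ‖q‖ = 1) (hv2 : ‖v‖ ≤ 2) :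
    |B u v| ≤ |B q v'| + 3 * Λ * η := by
  have e : B u v = B q v' + B (u - q) v + B q (v - v') := by rw [hl, hr]; ring
  have h1 : |B (u - q) v| ≤ Λ * (η * 2) := (hB _ _).trans (by gcongr)
  have h2 : |B q (v - v')| ≤ Λ * (1 * η) := (hB _ _).trans (by rw [hq]; gcongr)
  rw [e]
  refine (abs_add_three _ _ _).trans ?_
  linarith

/-- Passage from the net to all directions. The discretization error of `v` is of order `e²`,
hence at most `e * ‖v‖` for the vectors `v` which are not already of the order `e` of the
statistical error. -/
theorem abs_empForm_sub_le_of_net {m n : ℕ} {a : Fin m → Vec n} {w : Fin m → ℝ} {x : Vec n}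
    {K ν τ e g : ℝ} {F : Finset (Vec n)} (hx : ‖x‖ = 1) (hn : 1 ≤ n) (hK : 0 < K) (hg : 1 ≤ g)
    (hν : 0 < ν) (hνK : ν ≤ 68 * g * K) (hτ : 0 ≤ τ) (hτν : τ ≤ ν) (he0 : 0 < e) (he1 : e ≤ 1 / 2)
    (h1 : ∀ u ∈ F, ∀ v ∈ F, |empForm a w u v - ν * (inner ℝ x u * inner ℝ x v)| ≤
      14000 * g * K * e * (‖u‖ * ‖v‖) + τ * |inner ℝ x u * inner ℝ x v|)
    (h2 : ∀ u ∈ F, ∀ v ∈ F, |empForm a 1 u v - inner ℝ u v| ≤ 306 * e * (‖u‖ * ‖v‖))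
    (hw : (1 / (m : ℝ)) * ∑ i, w i ^ 2 ≤ 128 * K ^ 2)
    (ha : (1 / (m : ℝ)) * ∑ i, ‖a i‖ ^ 4 ≤ 2 * ((n : ℝ) ^ 2 * g))
    {u q v v' : Vec n} (hq : q ∈ F) (hv' : v' ∈ F) (hq1 : ‖q‖ = 1)
    (hu : ‖u - q‖ ≤ e ^ 2 / n) (hv : ‖v - v'‖ ≤ e ^ 2 / n) (hv2 : ‖v‖ ≤ 2) (hve : e ≤ ‖v‖) :
    |empForm a w u v - ν * (inner ℝ x u * inner ℝ x v)| ≤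
      29000 * g * K * e * ‖v‖ + τ * |inner ℝ x v| ∧
    |empForm a 1 u v - inner ℝ u v| ≤ 700 * g * e * ‖v‖ := by
  have hn' : (1 : ℝ) ≤ n := by exact_mod_cast hn
  have hη0 : 0 ≤ e ^ 2 / n := by positivity
  have hη : e ^ 2 / n ≤ e ^ 2 := div_le_self (by positivity) hn'
  have hee : e ^ 2 ≤ e * ‖v‖ := by rw [sq]; gcongr
  have hev : e ^ 2 ≤ ‖v‖ := hee.trans (mul_le_of_le_one_left (norm_nonneg _) (by linarith))
  have hvv' : ‖v'‖ ≤ 2 * ‖v‖ := by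
    have := norm_le_insert' v' v
    rw [norm_sub_rev] at this
    linarith
  have hg2 : g ≤ g ^ 2 := by nlinarith
  have haB : (1 / (m : ℝ)) * ∑ i, ‖a i‖ ^ 4 ≤ (2 * n * g) ^ 2 := by
    refine ha.trans ?_
    have : (n : ℝ) ^ 2 * g ≤ (n : ℝ) ^ 2 * g ^ 2 := by gcongr
    nlinarith
  have hwA : (1 / (m : ℝ)) * ∑ i, w i ^ 2 ≤ (12 * K) ^ 2 := by nlinarith
  have h1A : (1 / (m : ℝ)) * ∑ i : Fin m, (1 : Fin m → ℝ) i ^ 2 ≤ (1 : ℝ) ^ 2 := by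
    simp only [Pi.one_apply, one_pow, Finset.sum_const, Finset.card_univ, Fintype.card_fin,
      nsmul_eq_mul, mul_one, one_div]
    exact inv_mul_le_one
  have hxle : ∀ z : Vec n, |(inner ℝ x z : ℝ)| ≤ ‖z‖ := fun z => by
    simpa [hx] using abs_real_inner_le_norm x z
  have hKe : 0 ≤ g * K * (e * ‖v‖) := by positivity
  constructor
  · have t1 := abs_le_add_of_bilinear
      (B := fun u v => empForm a w u v - ν * (inner ℝ x u * inner ℝ x v))
      (Λ := 12 * K * (2 * n * g) + ν)
      (fun u u' v => by simp only [empForm_sub_left, inner_sub_right]; ring)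
      (fun u v v' => by simp only [empForm_sub_right, inner_sub_right]; ring)
      (by positivity) hη0
      (fun u v => by
        refine (abs_sub _ _).trans ?_
        rw [add_mul]
        refine add_le_add (abs_empForm_le a w (by positivity) (by positivity) hwA haB u v) ?_
        rw [abs_mul, abs_of_pos hν, abs_mul]
        gcongr <;> exact hxle _) hu hv hq1 hv2
    refine t1.trans ?_
    have t2 := h1 q hq v' hv'
    rw [hq1, one_mul] at t2
    have t3 : τ * |inner ℝ x q * inner ℝ x v'| ≤ τ * |inner ℝ x v| + 68 * (g * K * (e * ‖v‖)) := by
      have w1 : |(inner ℝ x q : ℝ) * inner ℝ x v'| ≤ |inner ℝ x v| + e ^ 2 / n := by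
        rw [abs_mul]
        have w2 : |(inner ℝ x q : ℝ)| ≤ 1 := (hxle q).trans_eq hq1
        have w3 : |(inner ℝ x v' : ℝ)| ≤ |inner ℝ x v| + e ^ 2 / n := by
          have w4 := hxle (v' - v)
          rw [inner_sub_right, norm_sub_rev] at w4
          have := abs_sub_abs_le_abs_sub (inner ℝ x v' : ℝ) (inner ℝ x v)
          linarith
        exact (mul_le_of_le_one_left (abs_nonneg _) w2).trans w3
      have w5 : τ * (e ^ 2 / n) ≤ 68 * g * K * (e * ‖v‖) :=
        mul_le_mul (hτν.trans hνK) (hη.trans hee) hη0 (by positivity)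
      have := mul_le_mul_of_nonneg_left w1 hτ
      linarith
    have t4 : 14000 * g * K * e * ‖v'‖ ≤ 14000 * g * K * e * (2 * ‖v‖) := by gcongr
    have t5 : 3 * (12 * K * (2 * n * g) + ν) * (e ^ 2 / n) ≤ 276 * (g * K * (e * ‖v‖)) := by
      have w1 : 3 * (12 * K * (2 * n * g) + ν) * (e ^ 2 / n) =
          72 * (g * K) * e ^ 2 + 3 * ν * (e ^ 2 / n) := by field_simp; ring
      have w2 : 72 * (g * K) * e ^ 2 ≤ 72 * (g * K) * (e * ‖v‖) := by gcongr
      have w3 : 3 * ν * (e ^ 2 / n) ≤ 3 * (68 * g * K) * (e * ‖v‖) :=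
        mul_le_mul (by linarith) (hη.trans hee) hη0 (by positivity)
      linarith
    linarith
  · have t1 := abs_le_add_of_bilinear (B := fun u v => empForm a 1 u v - inner ℝ u v)
      (Λ := 1 * (2 * n * g) + 1)
      (fun u u' v => by simp only [empForm_sub_left, inner_sub_left]; ring)
      (fun u v v' => by simp only [empForm_sub_right, inner_sub_right]; ring)
      (by positivity) hη0
      (fun u v => by
        refine (abs_sub _ _).trans ?_
        rw [add_mul]
        refine add_le_add (abs_empForm_le a 1 zero_le_one (by positivity) h1A haB u v) ?_
        rw [one_mul]
        exact abs_real_inner_le_norm u v) hu hv hq1 hv2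
    refine t1.trans ?_
    have t2 := h2 q hq v' hv'
    rw [hq1, one_mul] at t2
    have t4 : 306 * e * ‖v'‖ ≤ 306 * e * (2 * ‖v‖) := by gcongr
    have t5 : 3 * (1 * (2 * n * g) + 1) * (e ^ 2 / n) ≤ 9 * g * (e * ‖v‖) := by
      have w1 : 3 * (1 * (2 * n * g) + 1) * (e ^ 2 / n) =
          6 * g * e ^ 2 + 3 * (e ^ 2 / n) := by field_simp; ring
      have w2 : 6 * g * e ^ 2 ≤ 6 * g * (e * ‖v‖) := by gcongr
      have w3 : 1 * (e * ‖v‖) ≤ g * (e * ‖v‖) := by gcongr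
      linarith
    have t6 : 1 * (e * ‖v‖) ≤ g * (e * ‖v‖) := by gcongr
    have t7 : 0 ≤ e * ‖v‖ := by positivity
    linarith

/-- One step of the iteration, under the regularity of the sample on a net. -/
theorem norm_step_le_of_net {k m n : ℕ} {G : Vec k → Vec n} {L : ℝ≥0} {r : ℝ} {a : Fin m → Vec n}
    {y : Fin m → ℝ} {x : Vec n} {ζ K ν τ e g β₁ β₂ : ℝ} {N F : Finset (Vec n)}
    (hG : IsGenModel G L r) (hxG : x ∈ genRange G r)
    (hn : 1 ≤ n) (hζ : 0 < ζ) (hK : 0 < K) (hg : 1 ≤ g)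
    (hν : 0 < ν) (hνK : ν ≤ 68 * g * K) (hτ : 0 ≤ τ) (hτν : τ ≤ ν) (hβ₂ : 0 < β₂)
    (hτ1 : 2 * ζ * τ ≤ β₁ / 4) (hτ2 : 2 * ζ * τ ≤ 1 / 2) (he0 : 0 < e) (he1 : e ≤ 1 / 2)
    (hN : ∀ q ∈ N, q ∈ genRange G r) (hnet : ∀ u ∈ genRange G r, ∃ q ∈ N, ‖u - q‖ ≤ e ^ 2 / n)
    (hNF : ∀ q ∈ N, q ∈ F ∧ q - x ∈ F)
    (h1 : ∀ u ∈ F, ∀ v ∈ F, |empForm a (fun i => y i - empMean y) u v -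
      ν * (inner ℝ x u * inner ℝ x v)| ≤
      14000 * g * K * e * (‖u‖ * ‖v‖) + τ * |inner ℝ x u * inner ℝ x v|)
    (h2 : ∀ u ∈ F, ∀ v ∈ F, |empForm a 1 u v - inner ℝ u v| ≤ 306 * e * (‖u‖ * ‖v‖))
    (hw : (1 / (m : ℝ)) * ∑ i, (y i - empMean y) ^ 2 ≤ 128 * K ^ 2)
    (ha : (1 / (m : ℝ)) * ∑ i, ‖a i‖ ^ 4 ≤ 2 * ((n : ℝ) ^ 2 * g))
    {u p : Vec n} (hu : u ∈ genRange G r) (hp : IsProjection G r (gradStep ζ a y u) p)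
    (hδ : 2 * |1 - ζ * ν| + 5 * ζ * ν * ‖u - x‖ + β₁ / 2 ≤ 1 - β₂) :
    ‖p - x‖ ≤ (1 - β₂) * ‖u - x‖ + (50000000 * ζ * g ^ 2 + 68 * g / ν) * K * e := by
  have hpG : p ∈ genRange G r := by
    obtain ⟨z, hz, -, rfl⟩ := hp
    exact ⟨z, hz, rfl⟩
  have hunit : ∀ v ∈ genRange G r, ‖v‖ = 1 := by
    rintro _ ⟨z, hz, rfl⟩; exact hG.unit_range z hz
  have hb0 : 0 ≤ 1 - β₂ := by
    have h3 : 0 ≤ β₁ := by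
      have : 0 ≤ 2 * ζ * τ := by positivity
      linarith
    have h4 : 0 ≤ 5 * ζ * ν * ‖u - x‖ := by positivity
    have h5 := abs_nonneg (1 - ζ * ν)
    linarith
  have hδ0 := mul_nonneg hb0 (norm_nonneg (u - x))
  have hgK : 0 < g * K := by positivity
  rcases lt_or_ge ‖p - x‖ e with hlt | hge
  · -- An error below `e` is within the additive term, since `ν ≤ 68 g K`.
    have h3 : e ≤ 68 * g / ν * K * e := by
      have : 1 ≤ 68 * g / ν * K := by
        rw [div_mul_eq_mul_div, le_div_iff₀ hν]; linarith
      exact le_mul_of_one_le_left he0.le this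
    have h4 : 0 ≤ 50000000 * ζ * g ^ 2 * K * e := by positivity
    linarith
  · obtain ⟨q, hqN, hq⟩ := hnet u hu
    obtain ⟨q', hqN', hq'⟩ := hnet p hpG
    have hx1 := hunit x hxG
    have hu1 := hunit u hu
    have hp1 := hunit p hpG
    have hq1 := hunit q (hN q hqN)
    have e1 := abs_empForm_sub_le_of_net hx1 hn hK hg hν hνK hτ hτν he0 he1 h1 h2 hw ha
      (hNF q hqN).1 (hNF q' hqN').2 hq1 hq (v := p - x) (v' := q' - x) (by simpa using hq')
      (norm_sub_le_two hx1 hp1) hge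
    have e2 := (abs_empForm_sub_le_of_net hx1 hn hK hg hν hνK hτ hτν he0 he1 h1 h2 hw ha
      (hNF q hqN).1 (hNF q hqN).1 hq1 hq (v := u) hq (by rw [hu1]; norm_num)
      (by rw [hu1]; linarith)).1
    have hxu : |(inner ℝ x u : ℝ)| ≤ 1 := by
      simpa [hx1, hu1] using abs_real_inner_le_norm x u
    have hxv := inner_sub_eq_of_norm_eq_one hx1 hp1
    have key := norm_step_le hxG hx1 hu1 hp1 hζ hν hτ (b := 29000 * g * K * e) (b' := 700 * g * e)
      (by positivity) hp (he0.trans_le hge) e1.1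
      (by
        rw [hu1, mul_one, ← sq] at e2
        refine e2.trans ?_
        have := mul_le_mul_of_nonneg_left hxu hτ
        linarith) e1.2
    set s := 2 * ζ * τ with hs
    have hs0 : 0 ≤ s := by positivity
    have hε : 2 * ζ * ((ν + 29000 * g * K * e + τ) * (700 * g * e) + 4 * (29000 * g * K * e)) ≤
        25000000 * ζ * g ^ 2 * K * e := by
      have w1 : ν + 29000 * g * K * e + τ ≤ 15000 * (g * K) := by
        have : g * K * e ≤ g * K * (1 / 2) := by gcongr
        linarith
      have w2 : (ν + 29000 * g * K * e + τ) * (700 * g * e) ≤ 15000 * (g * K) * (700 * g * e) := by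
        gcongr
      have w3 : 1 * (g * K * e) ≤ g * (g * K * e) := by gcongr
      have w4 : (ν + 29000 * g * K * e + τ) * (700 * g * e) + 4 * (29000 * g * K * e) ≤
          12000000 * (g * (g * K * e)) := by linarith [show 0 ≤ g * (g * K * e) by positivity]
      have w5 := mul_le_mul_of_nonneg_left w4 (by positivity : 0 ≤ 2 * ζ)
      have w6 : 0 ≤ ζ * (g * (g * K * e)) := by positivity
      linarith
    have hcoef : (2 * |1 - ζ * ν| + 5 * ζ * ν * ‖u - x‖ + s) * ‖u - x‖ ≤
        (1 - s) * ((1 - β₂) * ‖u - x‖) := by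
      rw [← mul_assoc]
      refine mul_le_mul_of_nonneg_right ?_ (norm_nonneg _)
      have := mul_nonneg hs0 hβ₂.le
      linarith
    have hfin : (1 - s) * ‖p - x‖ ≤
        (1 - s) * ((1 - β₂) * ‖u - x‖ + 50000000 * ζ * g ^ 2 * K * e) := by
      have : 1 / 2 * (50000000 * ζ * g ^ 2 * K * e) ≤ (1 - s) * (50000000 * ζ * g ^ 2 * K * e) := by
        gcongr; linarith
      linarith
    have h3 := le_of_mul_le_mul_left hfin (by linarith)
    have h4 : 0 ≤ 68 * g / ν * K * e := by positivity
    linarith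

/-! ### The contraction event and the number of steps -/

/-- With probability `1 - O(1/m)`, a step of the iteration contracts the error at every point of the
range at once. -/
theorem IsDesign.exists_contraction_event {Ω Ξ : Type*} [MeasurableSpace Ω] [MeasurableSpace Ξ]
    {P : Measure Ω} [IsProbabilityMeasure P] {k m n : ℕ} {a : Fin m → Ω → Vec n}
    {ξ : Fin m → Ω → Ξ} (hd : IsDesign P a ξ) {G : Vec k → Vec n} {L : ℝ≥0} {r : ℝ}
    (hG : IsGenModel G L r) {x : Vec n} (hxG : x ∈ genRange G r) (hm : 2 ≤ m) (hk : 1 ≤ k)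
    (hR : 2 ≤ n * L * r) {f : ℝ → Ξ → ℝ} (hf : Measurable (Function.uncurry f))
    {ζ K ν τ e β₁ β₂ : ℝ} (hζ : 0 < ζ) (hK : 0 < K) (hν0 : 0 < ν) (hβ₂ : 0 < β₂)
    (hYK : ∀ i, psiOneNorm (observation f x (a i) (ξ i)) P ≤ ENNReal.ofReal K)
    (hν : ∀ i, cov[observation f x (a i) (ξ i), fun ω => (inner ℝ (a i ω) x) ^ 2; P] = ν)
    (hτ : 0 < τ) (hτν : τ ≤ ν) (hτ1 : 2 * ζ * τ ≤ β₁ / 4) (hτ2 : 2 * ζ * τ ≤ 1 / 2)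
    (hmτ : (64 * gaussMoment * (1 + K) * (1 + 2 * gaussMoment + 4 * K) / τ) ^ 4 ≤ m)
    (he0 : 0 < e) (he1 : e ≤ 1 / 2) (he : m * e ^ 2 = complexity m n k L r) :
    ∃ A : Set Ω, MeasurableSet A ∧ 1 - 349 / m ≤ P.real A ∧
      ∀ ω ∈ A, ∀ u ∈ genRange G r, ∀ p, IsProjection G r (gradStep ζ (fun i => a i ω)
          (fun i => observation f x (a i) (ξ i) ω) u) p →
        2 * |1 - ζ * ν| + 5 * ζ * ν * ‖u - x‖ + β₁ / 2 ≤ 1 - β₂ →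
        ‖p - x‖ ≤ (1 - β₂) * ‖u - x‖ +
          (50000000 * ζ * gaussMoment ^ 2 + 68 * gaussMoment / ν) * K * e := by
  classical
  have hM := one_le_gaussMoment
  have hm' : (0 : ℝ) < m := by positivity
  have hn : 1 ≤ n := by
    rcases Nat.eq_zero_or_pos n with rfl | h
    · norm_num at hR
    · exact h
  have hn' : (0 : ℝ) < n := by positivity
  have hr := hG.radius_pos
  have hL : 0 < L := by
    rcases eq_or_lt_of_le (zero_le (a := L)) with h | h
    · rw [← h] at hR; norm_num at hR
    · exact h
  have hx1 : ‖x‖ = 1 := by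
    obtain ⟨z, hz, rfl⟩ := hxG; exact hG.unit_range z hz
  obtain ⟨N, hN, hcard, hnet⟩ := exists_finset_net hG hL (η := e ^ 2 / n) (by positivity)
  have hcard' : (N.card : ℝ) ≤ (1 + 2 * (n * L * r) / e ^ 2) ^ k := by
    refine hcard.trans_eq ?_
    congr 2
    field_simp
  have hN1 : (1 : ℝ) ≤ N.card := by
    obtain ⟨q, hq, -⟩ := hnet x hxG
    exact_mod_cast Finset.card_pos.2 ⟨q, hq⟩
  -- The choice of `D` makes a union bound over `F × F` cost `12 / m`.
  set D : ℝ := 2 * Real.log (2 * N.card) + Real.log m with hD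
  obtain ⟨hD0, hD1, hD2⟩ := log_card_bounds hm hk hR he0 he1 he hN1 hcard' hD
  -- The forms are evaluated at iterates and at differences of iterates with `x`.
  set F : Finset (Vec n) := N ∪ N.image (fun q => q - x) with hF
  have hFcard : (F.card : ℝ) ≤ 2 * N.card := by
    have h1 : F.card ≤ N.card + (N.image fun q => q - x).card := Finset.card_union_le _ _
    have h2 : (N.image fun q => q - x).card ≤ N.card := Finset.card_image_le
    exact_mod_cast (by omega : F.card ≤ 2 * N.card)
  have hNF : ∀ q ∈ N, q ∈ F ∧ q - x ∈ F := fun q hq =>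
    ⟨Finset.mem_union_left _ hq, Finset.mem_union_right _ (Finset.mem_image_of_mem _ hq)⟩
  obtain ⟨A, hA, hPA, hAω⟩ := hd.exists_regular_event hx1 hm hf hK hYK hν hτ hmτ hD0 F
  refine ⟨A, hA, le_trans ?_ hPA, fun ω hω u hu p hp hδ => ?_⟩
  · have hexp : Real.exp (-D) = 1 / ((2 * N.card) ^ 2 * m) := by
      rw [hD, Real.exp_neg, Real.exp_add, Real.exp_log hm', two_mul (Real.log _), Real.exp_add,
        Real.exp_log (by positivity), sq, one_div]
    have h1 : (F.card : ℝ) ^ 2 * (12 * Real.exp (-D)) ≤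
        (2 * N.card) ^ 2 * (12 * Real.exp (-D)) := by gcongr
    have h2 : (2 * N.card : ℝ) ^ 2 * (12 * Real.exp (-D)) = 12 / m := by
      rw [hexp]; field_simp
    have h3 : (349 : ℝ) / m = 337 / m + 12 / m := by ring
    linarith
  · obtain ⟨c1, c2, c3, c4⟩ := hAω ω hω _ rfl
    obtain ⟨d1, d2⟩ := deviation_bounds (K := K) (by omega : 1 ≤ m) he0 he1 hK hM hD0 hD1 hD2
    have i₀ : Fin m := ⟨0, by omega⟩
    have hνK : ν ≤ 68 * gaussMoment * K := by
      rw [← hν i₀]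
      exact covariance_le_of_psiOneNorm (hd.measurable_vec i₀) (hd.gaussian i₀) hx1
        (measurable_observation hf (hd.measurable_vec i₀) (hd.measurable_noise i₀)) hK (hYK i₀)
    refine norm_step_le_of_net hG hxG hn hζ hK hM hν0 hνK hτ.le hτν hβ₂ hτ1 hτ2 he0 he1 hN hnet hNF
      (fun u hu v hv => (c1 u hu v hv).trans ?_) (fun u hu v hv => (c2 u hu v hv).trans ?_) c3 c4
      hu hp hδ
    · gcongr
    · gcongr

/-- The number of steps after which `(1 - β₂) ^ N` is below the statistical error `c * e`; the
logarithm of `1 / e` is bounded below, so it absorbs the additive constants. -/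
theorem exists_nat_pow_le {β₂ c e : ℝ} (hβ₂ : 0 < β₂) (hβ₂' : β₂ ≤ 1) (hc : 0 < c) (he0 : 0 < e)
    (he1 : e ≤ 1 / 2) :
    ∃ N : ℕ, (1 - β₂) ^ N * 2 ≤ c * e / 2 ∧
      (N : ℝ) ≤ (|Real.log (4 / c)| / β₂ + 1 / β₂ + 1) * (2 * Real.log (1 / e)) := by
  have hl : 1 ≤ 2 * Real.log (1 / e) := by
    have h1 : Real.log 2 ≤ Real.log (1 / e) :=
      Real.log_le_log (by norm_num) (by rw [le_div_iff₀ he0]; linarith)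
    linarith [Real.log_two_gt_d9]
  have hlog : Real.log (4 / (c * e)) = Real.log (4 / c) + Real.log (1 / e) := by
    rw [← Real.log_mul (by positivity) (by positivity)]
    congr 1
    field_simp
  refine ⟨⌈Real.log (4 / (c * e)) / β₂⌉₊, ?_, ?_⟩
  · set N := ⌈Real.log (4 / (c * e)) / β₂⌉₊
    have h1 : Real.log (4 / (c * e)) ≤ N * β₂ := by
      rw [← div_le_iff₀ hβ₂]; exact Nat.le_ceil _
    have h2 : (1 - β₂) ^ N ≤ Real.exp (-(N * β₂)) := by
      rw [← mul_neg, Real.exp_nat_mul]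
      exact pow_le_pow_left₀ (by linarith) (by linarith [Real.add_one_le_exp (-β₂)]) N
    have h3 : Real.exp (-(N * β₂)) ≤ c * e / 4 := by
      rw [← inv_div, Real.exp_neg]
      refine inv_anti₀ (by positivity) ?_
      rw [← Real.log_le_iff_le_exp (by positivity)]
      exact h1
    linarith
  · have h1 : (⌈Real.log (4 / (c * e)) / β₂⌉₊ : ℝ) ≤ |Real.log (4 / (c * e)) / β₂| + 1 := by
      refine le_trans ?_ (Nat.ceil_lt_add_one (abs_nonneg _)).le
      exact_mod_cast Nat.ceil_mono (le_abs_self _)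
    refine h1.trans ?_
    rw [hlog, abs_div, abs_of_pos hβ₂]
    have h2 : |Real.log (4 / c) + Real.log (1 / e)| ≤ |Real.log (4 / c)| + Real.log (1 / e) := by
      refine (abs_add_le _ _).trans_eq ?_
      rw [abs_of_nonneg (a := Real.log (1 / e)) (by linarith)]
    have h3 : |Real.log (4 / c) + Real.log (1 / e)| / β₂ ≤
        (|Real.log (4 / c)| + 2 * Real.log (1 / e)) / β₂ := by
      gcongr; linarith
    have h4 : |Real.log (4 / c)| / β₂ * 1 ≤ |Real.log (4 / c)| / β₂ * (2 * Real.log (1 / e)) := by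
      gcongr
    rw [add_div] at h3
    have h5 : (|Real.log (4 / c)| / β₂ + 1 / β₂ + 1) * (2 * Real.log (1 / e)) =
        |Real.log (4 / c)| / β₂ * (2 * Real.log (1 / e)) + 2 * Real.log (1 / e) / β₂ +
          2 * Real.log (1 / e) := by ring
    linarith


end MPR

theorem theorem2 :
    -- `C₁`: constant of the failure probability `O(1/m)`
    ∃ C₁ : ℝ, 0 < C₁ ∧ ∀ ζ ν : ℝ, 0 < ζ → 0 < ν →
    -- `C`: constant of the statistical error
    ∃ C : ℝ, 0 < C ∧ ∀ Ky β₁ β₂ : ℝ, 0 < Ky → 0 < β₁ → 0 < β₂ →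
    -- `C₀`: constant of the sample size; `C₂`: constant of the number of steps
    ∃ C₀ C₂ : ℝ, 0 < C₀ ∧ 0 < C₂ ∧
    ∀ (m n k : ℕ) (L : ℝ≥0) (r : ℝ) (G : MPR.Vec k → MPR.Vec n) (x : MPR.Vec n)
      (Ω Ξ : Type*) [MeasurableSpace Ω] [MeasurableSpace Ξ] (P : Measure Ω)
      [IsProbabilityMeasure P]
      (a : Fin m → Ω → MPR.Vec n) (ξ : Fin m → Ω → Ξ) (f : ℝ → Ξ → ℝ),
      1 ≤ m → 1 ≤ k → 2 ≤ n * L * r →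
      MPR.IsGenModel G L r → x ∈ MPR.genRange G r →
      MPR.IsDesign P a ξ → Measurable (Function.uncurry f) →
      (∀ i, MPR.psiOneNorm (MPR.observation f x (a i) (ξ i)) P = ENNReal.ofReal Ky) →
      (∀ i, cov[MPR.observation f x (a i) (ξ i), fun ω => (inner ℝ (a i ω) x) ^ 2; P] = ν) →
      C₀ * MPR.complexity m n k L r ≤ m →
      ∃ A : Set Ω, MeasurableSet A ∧ 1 - C₁ / m ≤ P.real A ∧ ∀ ω ∈ A, ∀ X : ℕ → MPR.Vec n,
        MPR.IsSecondStep G r ζ (fun i => a i ω)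
          (fun i => MPR.observation f x (a i) (ξ i) ω) X →
        2 * |1 - ζ * ν| + 5 * ζ * ν * ‖X 0 - x‖ + β₁ ≤ 1 - β₂ →
        ∃ T₀ : ℕ, (T₀ : ℝ) ≤ C₂ * Real.log (m / MPR.complexity m n k L r) ∧
          StrictAntiOn (fun t => ‖X t - x‖) (Set.Icc 0 T₀) ∧
          (∀ t ≤ T₀, ‖X t - x‖ < (1 - β₂) ^ t * ‖X 0 - x‖
            + C * Ky / β₂ * Real.sqrt (MPR.complexity m n k L r / m)) ∧
          ∀ t ≥ T₀, ‖X t - x‖ ≤ C * Ky / β₂ * Real.sqrt (MPR.complexity m n k L r / m) := by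
  open MPR in
  have hM := one_le_gaussMoment
  refine ⟨349, by norm_num, fun ζ ν hζ hν => ⟨2 * (50000000 * ζ * gaussMoment ^ 2 +
    68 * gaussMoment / ν), by positivity, fun K β₁ β₂ hK hβ₁ hβ₂ => ?_⟩⟩
  set C : ℝ := 2 * (50000000 * ζ * gaussMoment ^ 2 + 68 * gaussMoment / ν) with hC
  have hC0 : 0 < C := by positivity
  -- The error `τ` allowed in the direction of the signal perturbs the contraction factor by less
  -- than `β₁`.
  set τ : ℝ := min ν (min (β₁ / (8 * ζ)) (1 / (4 * ζ))) with hτdef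
  have hτ : 0 < τ := by positivity
  have hτν : τ ≤ ν := min_le_left _ _
  have hτ1 : 2 * ζ * τ ≤ β₁ / 4 := by
    have h1 : τ ≤ β₁ / (8 * ζ) := (min_le_right _ _).trans (min_le_left _ _)
    rw [le_div_iff₀ (by positivity)] at h1
    linarith
  have hτ2 : 2 * ζ * τ ≤ 1 / 2 := by
    have h1 : τ ≤ 1 / (4 * ζ) := (min_le_right _ _).trans (min_le_right _ _)
    rw [le_div_iff₀ (by positivity)] at h1
    linarith
  -- The lower bound `Z` on `m` gives the sample means the accuracy `τ`, and the one by `b ^ 2` makes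
  -- the statistical error so small that the contraction is available from there on.
  set Z : ℝ := (64 * gaussMoment * (1 + K) * (1 + 2 * gaussMoment + 4 * K) / τ) ^ 4 with hZ
  have hZ0 : 0 < Z := by positivity
  set c : ℝ := C * K / β₂ with hc
  have hc0 : 0 < c := by positivity
  set b : ℝ := 5 * ζ * ν * c * (2 / β₁) with hb
  have hb0 : 0 < b := by positivity
  refine ⟨4 + 4 * Z + b ^ 2, |Real.log (4 / c)| / β₂ + 1 / β₂ + 1, by positivity, by positivity, ?_⟩
  intro m n k L r G x Ω Ξ _ _ P _ a ξ f hm1 hk hR hG hxG hd hf hYK hcov hmκ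
  rcases hm1.eq_or_lt with rfl | hm
  -- For `m = 1` the lower bound on the probability is negative.
  · refine ⟨∅, MeasurableSet.empty, by norm_num, by simp⟩
  have hm2 : (2 : ℝ) ≤ m := by exact_mod_cast hm
  have hm0 : (0 : ℝ) < m := by positivity
  have hκ : 1 / 4 ≤ complexity m n k L r := by
    have hl2 := Real.log_two_gt_d9
    have hℓ : Real.log 2 ≤ Real.log (n * L * r) := Real.log_le_log (by norm_num) hR
    have hlm : Real.log 2 ≤ Real.log m := Real.log_le_log (by norm_num) hm2
    have hk' : (1 : ℝ) ≤ k := by exact_mod_cast hk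
    have h1 : 1 / 2 ≤ k * Real.log (n * L * r) := by nlinarith
    unfold complexity
    nlinarith
  set κ := complexity m n k L r with hκdef
  set e : ℝ := √(κ / m) with hedef
  have he0 : 0 < e := Real.sqrt_pos.2 (by positivity)
  have hesq : e ^ 2 = κ / m := Real.sq_sqrt (by positivity)
  have he : m * e ^ 2 = κ := by rw [hesq]; field_simp
  have hbκ : 0 ≤ b ^ 2 * κ := by positivity
  have hZκ : 0 ≤ (Z * κ) := by positivity
  have he1 : e ≤ 1 / 2 := by
    refine le_of_sq_le_sq ?_ (by norm_num)
    rw [hesq, div_le_iff₀ hm0]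
    linarith
  have hbe : b * e ≤ 1 := by
    refine le_of_sq_le_sq ?_ zero_le_one
    rw [mul_pow, hesq, ← mul_div_assoc, one_pow, div_le_one hm0]
    linarith
  have hmZ : Z ≤ m := by nlinarith
  obtain ⟨A, hA, hPA, hAω⟩ := hd.exists_contraction_event hG hxG hm hk hR hf hζ hK hν hβ₂
    (fun i => (hYK i).le) hcov hτ hτν hτ1 hτ2 hmZ he0 he1 he
  refine ⟨A, hA, hPA, fun ω hω X hX h0 => ?_⟩
  have hXG : ∀ t, X t ∈ genRange G r := by
    rintro (_ | t)
    · exact hX.init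
    · obtain ⟨z, hz, -, h⟩ := hX.step t
      exact ⟨z, hz, h.symm⟩
  have hunit : ∀ v ∈ genRange G r, ‖v‖ = 1 := by
    rintro _ ⟨z, hz, rfl⟩; exact hG.unit_range z hz
  have hβ₂1 : β₂ ≤ 1 := by
    have := abs_nonneg (1 - ζ * ν)
    have : 0 ≤ 5 * ζ * ν * ‖X 0 - x‖ := by positivity
    linarith
  obtain ⟨N, hN, hNle⟩ := exists_nat_pow_le hβ₂ hβ₂1 hc0 he0 he1
  obtain ⟨T₀, hT₀, hanti, hlt, hle⟩ := exists_stopping_time (d := fun t => ‖X t - x‖)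
    (ρ := 2 * |1 - ζ * ν|) (θ := 5 * ζ * ν) (E := c * e) (ε := C / 2 * K * e)
    (fun t => norm_nonneg _) (norm_sub_le_two (hunit x hxG) (hunit _ hX.init)) (by positivity)
    (by positivity) hβ₁ hβ₂ (by positivity)
    (le_of_eq (by rw [hc]; field_simp)) (by positivity)
    (by
      have h1 : 5 * ζ * ν * (c * e) = b * e * (β₁ / 2) := by rw [hb]; field_simp
      rw [h1]
      exact mul_le_of_le_one_left (by positivity) hbe) h0
    (fun t ht => by
      refine (hAω ω hω (X t) (hXG t) (X (t + 1)) (hX.step t) ht).trans_eq ?_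
      rw [hC]; ring) hN
  refine ⟨T₀, ?_, hanti, fun t _ => hlt t, hle⟩
  have hlog : Real.log (m / κ) = 2 * Real.log (1 / e) := by
    have h1 : (m : ℝ) / κ = (1 / e) ^ 2 := by rw [div_pow, one_pow, hesq, one_div_div]
    rw [h1, Real.log_pow]; push_cast; ring
  rw [hlog]
  exact (Nat.cast_le.2 hT₀).trans hNle
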